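/- Let $G$ be a connected finite graph (loops and multiple edges allowed) with edge set $E$ and a fixed reference orientation. A *cycle* is a set of edges $v_1v_2, v_2v_3,\dots,v_nv_1$ ($n\ge 1$ distinct edges, $v_1,\dots,v_n$ distinct vertices); traversing it in one of its two directions gives a *directed cycle*. A *cut* is the set of edges with exactly one endpoint in a given vertex set $W$; a *cocycle* is a non-empty cut that is minimal for inclusion among the non-empty cuts, and directing all its edges from $W$ to the complement, or all the other way, gives a *directed cocycle*. Directed cycles and cocycles are viewed as $\{0,\pm1\}$-vectors in $\mathbb{R}^E$, where $+1$ means agreement with the reference orientation. The points of $[0,1]^E$ are the *continuous orientations* and those of $\{0,1\}^E$ the *orientations*: coordinate $1$ at $e$ means that $e$ is oriented as in the reference orientation, $0$ means that it is oriented oppositely, and a coordinate in $(0,1)$ means that $e$ is *bi-oriented*. A directed cycle or cocycle is *in* an orientation $O$ if $O$ agrees with it on its support; *reversing* it gives the orientation $O-\vec C$. A cycle signature $\sigma$ chooses one directed cycle $\sigma(C)$ on each cycle $C$; it is *acyclic* if $\sum_C a_C\sigma(C)=0$ with all $a_C\ge 0$ forces all $a_C=0$. Acyclic cocycle signatures $\sigma^*$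 are defined in the same way with cocycles. Fix an acyclic cycle signature $\sigma$ and an acyclic cocycle signature $\sigma^*$. An orientation is *$\sigma$-compatible* if every directed cycle in it is chosen by $\sigma$, *$\sigma^*$-compatible* if every directed cocycle in it is chosen by $\sigma^*$, and *$(\sigma,\sigma^*)$-compatible* if it is both. Let $S_\sigma$ be the set of $\sigma$-compatible continuous orientations, i.e. of those $x\in[0,1]^E$ such that $x+\epsilon\sigma(C)\notin[0,1]^E$ for every $\epsilon>0$ and every cycle $C$. Let $D$ be the incidence matrix of the reference orientation ($+1$ at the head, $-1$ at the tail of a non-loop edge, $0$ otherwise) with the row of one arbitrary vertex removed, and let $\operatorname{im}_{\mathbb Z}(D^T)=\operatorname{im}(D^T)\cap\mathbb{Z}^E$. Spanning trees and spanning forests are identified with their edge sets. For a spanning tree $T$ let $C(T,e)$ be the unique cycle in $T\cup\{e\}$ if $e\notin T$, and $C^*(T,e)$ the unique cocycle in $(E\setminus T)\cup\{e\}$ if $e\in T$. Let $g_{\sigma,\sigma^*}(T)$ be the orientation in which each $e\notin T$ is oriented as in $\sigma(C(T,e))$ and each $e\in T$ as in $\sigma^*(C^*(T,e))$. Let $\mathrm{hoc}_{\sigma,\sigma^*}(T)$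 be the set of continuous orientations in which each $e\notin T$ is oriented as in $\sigma(C(T,e))$ and each $e\in T$ is oriented as in $\sigma^*(C^*(T,e))$ or bi-oriented. A *standard half-open cell* with *generating set* $F\subseteq E$ is a product $\prod_{e\in E} I_e$ such that, for some integers $a_e$, $I_e=\{a_e\}$ for $e\notin F$ and $I_e$ is $(a_e-1,a_e]$ or $[a_e,a_e+1)$ for $e\in F$. Then the following hold. 1. $$S_\sigma=\biguplus_{T,\ \vec{C^*}}\bigl(\mathrm{hoc}_{\sigma,\sigma^*}(T)-\vec{C^*}\bigr)\cap[0,1]^E,$$ a disjoint union over all pairs of a spanning tree $T$ of $G$ and a vector $\vec{C^*}\in\operatorname{im}_{\mathbb Z}(D^T)$. Each non-empty summand is a standard half-open cell, and its generating set is a spanning forest contained in $T$. 2. The map $g_{\sigma,\sigma^*}$ is a bijection from the spanning trees of $G$ to the $(\sigma,\sigma^*)$-compatible orientations. For each $\sigma$-compatible orientation $O$ there is a unique $(\sigma,\sigma^*)$-compatible orientation $O^{cp}$ in the cocycle reversal class of $O$ (its class for the equivalence relation generated by reversals of directed cocycles), and $O$ is obtained from $O^{cp}$ by reversing pairwise disjoint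 directed cocycles in $O^{cp}$. 3. Every $\sigma$-compatible orientation $O$ lies in exactly one of the cells in 1; let $\varphi_{\sigma,\sigma^*}(O)$ be the generating set of that cell. Then for every set $\{\vec{C_j^*}\}_{j\in J}$ of pairwise disjoint directed cocycles in $O^{cp}$ whose reversal turns $O^{cp}$ into $O$, $$\varphi_{\sigma,\sigma^*}(O)=g_{\sigma,\sigma^*}^{-1}(O^{cp})\setminus\biguplus_{j\in J}C_j^*,$$ where $C_j^*$ is the set of edges of $\vec{C_j^*}$. The map $\varphi_{\sigma,\sigma^*}$ is a bijection from the $\sigma$-compatible orientations to the spanning forests of $G$. -/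

import Mathlib

/-- A graph with vertex type `V` and edge type `E`, loops and multiple edges allowed, together with
a reference orientation: the edge `e` joins `tail e` and `head e`, and its reference direction is
from `tail e` to `head e`. -/
structure OrientedGraph (V E : Type*) where
  tail : E → V
  head : E → V

/-- A signature chooses a direction for each cycle (or cocycle).  `IsC` says which edge sets are
cycles, `IsD` which vectors are directed cycles.  The value on other edge sets is fixed to be `0`,
so that a signature is precisely a choice of one directed cycle `dir C` for each cycle `C`. -/
structure Signature {E : Type*} (IsC : Set E → Prop) (IsD : (E → ℝ) → Prop) where
  dir : Set E → E → ℝ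
  isD_dir : ∀ C, IsC C → IsD (dir C)
  support_dir : ∀ C, IsC C → Function.support (dir C) = C
  dir_eq_zero : ∀ C, ¬ IsC C → dir C = 0

namespace Signature

variable {E : Type*} {IsC : Set E → Prop} {IsD : (E → ℝ) → Prop}

open Classical in
/-- The only nonnegative combination of the chosen directed cycles (cocycles) that vanishes is the
trivial one; the sum is over all cycles (cocycles). -/
def IsAcyclic [Fintype E] (σ : Signature IsC IsD) : Prop :=
  ∀ a : {C : Set E // IsC C} → ℝ, (∀ C, 0 ≤ a C) → ∑ C, a C • σ.dir C.1 = 0 → ∀ C, a C = 0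

/-- Membership in the signature, viewed as the set of the chosen directed cycles (cocycles). -/
def Chooses (σ : Signature IsC IsD) (c : E → ℝ) : Prop :=
  ∃ C, IsC C ∧ σ.dir C = c

end Signature

namespace OrientedGraph

variable {V E : Type*} (G : OrientedGraph V E)

/-- The spanning subgraph with edge set `S` is connected. -/
def IsConnectedOn (S : Set E) : Prop :=
  Nonempty V ∧ ∀ u v : V, Relation.ReflTransGen
    (fun a b => ∃ e ∈ S, (G.tail e = a ∧ G.head e = b) ∨ (G.head e = a ∧ G.tail e = b)) u v

/-- The graph is connected. -/
def IsConnected : Prop := G.IsConnectedOn Set.univ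

/-- Directed cycles as `{0, ±1}`-vectors: there are distinct vertices `v 0, …, v n` and distinct
edges `e 0, …, e n`, the edge `e i` joining `v i` to `v (i + 1)` (indices are cyclic in
`Fin (n + 1)`), and the coordinate of `c` at `e i` is `1` if the direction from `v i` to `v (i + 1)`
is the reference direction of `e i`, and `-1` if it is the opposite one.  A loop (`n = 0`) gives two
directed cycles. -/
def IsDirectedCycle (c : E → ℝ) : Prop :=
  ∃ (n : ℕ) (v : Fin (n + 1) → V) (e : Fin (n + 1) → E),
    Function.Injective v ∧ Function.Injective e ∧
    (∀ i, (G.tail (e i) = v i ∧ G.head (e i) = v (i + 1) ∧ c (e i) = 1) ∨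
      (G.head (e i) = v i ∧ G.tail (e i) = v (i + 1) ∧ c (e i) = -1)) ∧
    ∀ f, f ∉ Set.range e → c f = 0

/-- Cycles are the underlying edge sets of directed cycles. -/
def IsCycle (C : Set E) : Prop :=
  ∃ c : E → ℝ, G.IsDirectedCycle c ∧ Function.support c = C

/-- The cut of `W`: the edges with one endpoint in `W` and the other one not in `W`. -/
def cut (W : Set V) : Set E :=
  {e | (G.tail e ∈ W ∧ G.head e ∉ W) ∨ (G.head e ∈ W ∧ G.tail e ∉ W)}

open Classical in
/-- The cut of `W` with all its edges directed from `W` to the complement, as a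
`{0, ±1}`-vector. -/
noncomputable def cutVec (W : Set V) (e : E) : ℝ :=
  if G.tail e ∈ W ∧ G.head e ∉ W then 1 else if G.head e ∈ W ∧ G.tail e ∉ W then -1 else 0

/-- A cocycle is a nonempty cut that is minimal for inclusion among the nonempty cuts. -/
def IsCocycle (C : Set E) : Prop :=
  Minimal (fun S : Set E => S.Nonempty ∧ ∃ W, S = G.cut W) C

/-- Directed cocycles.  The opposite direction is covered by the complement of `W`. -/
def IsDirectedCocycle (c : E → ℝ) : Prop :=
  ∃ W, G.IsCocycle (G.cut W) ∧ c = G.cutVec W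

abbrev CycleSignature := Signature G.IsCycle G.IsDirectedCycle

abbrev CocycleSignature := Signature G.IsCocycle G.IsDirectedCocycle

/-- Spanning forests, as edge sets: sets of edges containing no cycle. -/
def IsForest (F : Set E) : Prop := ∀ C, G.IsCycle C → ¬ C ⊆ F

/-- Spanning trees, as edge sets. -/
def IsSpanningTree (T : Set E) : Prop := G.IsForest T ∧ G.IsConnectedOn T

/-- The fundamental cycle of `e ∉ T`: the unique cycle contained in `T ∪ {e}`. -/
noncomputable def fundCycle (T : Set E) (e : E) : Set E :=
  Classical.epsilon fun C => G.IsCycle C ∧ C ⊆ insert e T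

/-- The fundamental cocycle of `e ∈ T`: the unique cocycle contained in `(E \ T) ∪ {e}`. -/
noncomputable def fundCocycle (T : Set E) (e : E) : Set E :=
  Classical.epsilon fun C => G.IsCocycle C ∧ C ⊆ insert e Tᶜ

open Classical in
/-- The modified incidence matrix: the row of the vertex `q` is removed. -/
noncomputable def incMatrix (q : V) : Matrix {v : V // v ≠ q} E ℝ :=
  Matrix.of fun v e =>
    if G.tail e = G.head e then 0
    else if G.head e = v.1 then 1
    else if G.tail e = v.1 then -1
    else 0

open Classical in
/-- The integral vectors of the cocycle space, i.e. of the image of the transpose of the modified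
incidence matrix. -/
def intCocycleSpace [Fintype V] (q : V) : Set (E → ℝ) :=
  {x | (∃ y : {v : V // v ≠ q} → ℝ, (G.incMatrix q).transpose.mulVec y = x) ∧
    ∀ e, ∃ k : ℤ, x e = k}

/-- The continuous orientations, i.e. the cube `[0,1]^E`. -/
def cube (E : Type*) : Set (E → ℝ) := Set.Icc 0 1

/-- The (discrete) orientations, i.e. `{0,1}^E`; the reference orientation is `(1, …, 1)`. -/
def IsOrientation (O : E → ℝ) : Prop := ∀ e, O e = 0 ∨ O e = 1

/-- The coordinate, in a continuous orientation, of an edge that is oriented according to an arc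
with sign `s`: it is `1` if `s = 1` and `0` if `s = -1`. -/
noncomputable def arcCoord (s : ℝ) : ℝ := (1 + s) / 2

/-- The directed cycle or cocycle (or disjoint union of such) `c` is in the orientation `O`. -/
def IsIn (c O : E → ℝ) : Prop := ∀ e, c e ≠ 0 → O e = arcCoord (c e)

section Compatible

variable {G}
variable (σ : G.CycleSignature) (σs : G.CocycleSignature)

/-- The set `S_σ` of the `σ`-compatible continuous orientations. -/
def compatSet : Set (E → ℝ) :=
  {x | x ∈ cube E ∧ ∀ C, G.IsCycle C → ∀ ε : ℝ, 0 < ε → x + ε • σ.dir C ∉ cube E}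

/-- `σ`-compatible (discrete) orientations. -/
def IsCompat (O : E → ℝ) : Prop :=
  IsOrientation O ∧ ∀ c, G.IsDirectedCycle c → IsIn c O → σ.Chooses c

/-- `σ*`-compatible (discrete) orientations. -/
def IsCocompat (O : E → ℝ) : Prop :=
  IsOrientation O ∧ ∀ c, G.IsDirectedCocycle c → IsIn c O → σs.Chooses c

open Classical in
/-- The orientation `g_{σ,σ*}(T)`. -/
noncomputable def geomOrientation (T : Set E) (e : E) : ℝ :=
  if e ∈ T then arcCoord (σs.dir (G.fundCocycle T e) e)
  else arcCoord (σ.dir (G.fundCycle T e) e)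

/-- The half-open cell `hoc_{σ,σ*}(T)`: the edges outside `T` are oriented according to their
`σ`-directed fundamental cycles; each edge in `T` is oriented according to its `σ*`-directed
fundamental cocycle or is bi-oriented. -/
def hoc (T : Set E) : Set (E → ℝ) :=
  {x | x ∈ cube E ∧
    (∀ e, e ∉ T → x e = arcCoord (σ.dir (G.fundCycle T e) e)) ∧
    ∀ e, e ∈ T → x e = arcCoord (σs.dir (G.fundCocycle T e) e) ∨ (0 < x e ∧ x e < 1)}

/-- The set `(hoc_{σ,σ*}(T) - c) ∩ [0,1]^E`. -/
def cell (T : Set E) (c : E → ℝ) : Set (E → ℝ) :=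
  (fun x => x - c) '' hoc σ σs T ∩ cube E

end Compatible

/-- `H` is a standard half-open cell with generating set `F`: it is a product of sets `I e`, where
`I e` is `(a e - 1, a e]` or `[a e, a e + 1)` for `e ∈ F` and `{a e}` for `e ∉ F`, and the `a e` are
integers. -/
def IsStandardCell (H : Set (E → ℝ)) (F : Set E) : Prop :=
  ∃ (a : E → ℤ) (I : E → Set ℝ), H = Set.univ.pi I ∧
    (∀ e, e ∉ F → I e = {(a e : ℝ)}) ∧
    ∀ e, e ∈ F → I e = Set.Ioc ((a e : ℝ) - 1) (a e) ∨ I e = Set.Ico (a e : ℝ) ((a e : ℝ) + 1)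

/-- One cocycle reversal turns the orientation `O` into `O'`. -/
def CocycleReversal (O O' : E → ℝ) : Prop :=
  IsOrientation O ∧ ∃ c, G.IsDirectedCocycle c ∧ IsIn c O ∧ O' = O - c

/-- The orientations `O` and `O'` are in the same cocycle reversal class. -/
def SameCocycleClass (O O' : E → ℝ) : Prop := Relation.EqvGen G.CocycleReversal O O'

/-- `J` is a set of pairwise disjoint directed cocycles in `O₁`, and reversing all of them turns
`O₁` into `O`. -/
def ReversesTo (J : Finset (E → ℝ)) (O₁ O : E → ℝ) : Prop :=
  (∀ c ∈ J, G.IsDirectedCocycle c ∧ IsIn c O₁) ∧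
  (∀ c ∈ J, ∀ d ∈ J, c ≠ d → Disjoint (Function.support c) (Function.support d)) ∧
  O = O₁ - ∑ c ∈ J, c

end OrientedGraph

/-! By Gordan's theorem an acyclic signature consists of the directed cycles on which some linear
functional `w` is positive, and likewise for cocycles and a functional `ws`. The combinatorics then
takes place in a pair `U`, `Us` of orthogonal regular subspaces (flows and tensions), where cycles
and cocycles have symmetric roles and spanning trees are the bases.

For a base `T`, `ws` has a unique representative `t` modulo `U` supported in `T`, and `w` has a
unique representative `τ` modulo `Us` supported off `T`. Pairing with fundamental cocycles and
cycles shows that the signs of `t` and `τ` are the directions prescribed in `hoc`, so `hoc` is the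
half-open cell cut out by these signs.

Existence is linear programming (`IsRegularPair.exists_isBaseData_inOrthant`): minimise `w` over the
points of `ws + U` in a given orthant. An optimal vertex is supported in a base, and optimality
fixes the signs of `τ`. With the orthant read off from a point `y` of the cube, this puts `y` into a
cell (`IsRegularPair.exists_mem_halfOpenCell`), provided that `y` is compatible for both signatures.
A point compatible only with the cycle signature first gets there by the integral cocycle
translation that maximises `ws`.

Uniqueness comes from orthogonality. For two bases, `t - t'` is orthogonal to every tension, in
particular to `τ - τ'` and to differences of translations. In each pairing that is used all terms
have the same sign, so they vanish (`IsBaseData.eq_of_mem`, `IsBaseData.eq_of_generatingSet_eq`).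

The cell of `T` translated by `c` has generating set `{e ∈ T | c e = 0}`, which gives the formula
for `φ`. Injectivity is the second uniqueness statement. Surjectivity
(`IsRegularPair.exists_generatingSet_eq`) is the linear program again, with an orthant built from
the forest. -/

open scoped Matrix

namespace OrientedGraph

/-! ### Separation of convex sets and Gordan's theorem -/

section Separation

variable {E : Type*} [Fintype E]

theorem exists_dotProduct_eq (f : (E → ℝ) →ₗ[ℝ] ℝ) : ∃ s : E → ℝ, ∀ x, f x = s ⬝ᵥ x := by
  classical
  refine ⟨fun e => f (Pi.single e 1), fun x => ?_⟩
  conv_lhs => rw [pi_eq_sum_univ' x]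
  simp only [map_sum, map_smul, dotProduct, smul_eq_mul]
  refine Finset.sum_congr rfl fun e _ => ?_
  rw [mul_comm]

theorem exists_dotProduct_ne_zero {W : Submodule ℝ (E → ℝ)} {x : E → ℝ} (hx : x ∉ W) :
    ∃ s : E → ℝ, s ⬝ᵥ x ≠ 0 ∧ ∀ y ∈ W, s ⬝ᵥ y = 0 := by
  obtain ⟨f, hf, hW⟩ := Submodule.exists_le_ker_of_notMem hx
  obtain ⟨s, hs⟩ := exists_dotProduct_eq f
  exact ⟨s, by rwa [← hs], fun y hy => by rw [← hs]; exact hW hy⟩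

/-- Weak separation of a point from a convex set containing the origin. -/
theorem exists_ne_zero_forall_dotProduct_le {A : Set (E → ℝ)} (hA : Convex ℝ A) (h0 : 0 ∈ A)
    {x : E → ℝ} (hx : x ∉ A) : ∃ s : E → ℝ, s ≠ 0 ∧ ∀ a ∈ A, s ⬝ᵥ a ≤ s ⬝ᵥ x := by
  by_cases hint : (interior A).Nonempty
  · obtain ⟨f, hf, hle⟩ := geometric_hahn_banach_of_nonempty_interior_point hA
      (fun h => hx (interior_subset h)) hint
    obtain ⟨s, hs⟩ := exists_dotProduct_eq f.toLinearMap
    refine ⟨s, ?_, fun a ha => ?_⟩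
    · rintro rfl
      apply hf
      ext y
      simpa using hs y
    · have := hle a ha
      rw [← hs, ← hs]
      exact this
  -- As `A` contains the origin, empty interior means that `A` spans a proper subspace. A functional
  -- vanishing on it, with the sign adjusted at `x`, separates.
  · have hspan : Submodule.span ℝ A ≠ ⊤ := by
      intro h
      apply hint
      rw [hA.interior_nonempty_iff_affineSpan_eq_top]
      have h1 := affineSpan_insert_zero (k := ℝ) A
      rw [Set.insert_eq_of_mem h0, h] at h1
      exact SetLike.coe_injective h1
    obtain ⟨f, hf, hW⟩ := Submodule.exists_le_ker_of_lt_top _ hspan.lt_top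
    obtain ⟨s, hs⟩ := exists_dotProduct_eq f
    have hs0 : s ≠ 0 := by
      rintro rfl
      apply hf
      ext y
      simpa using hs _
    have hsA : ∀ a ∈ A, s ⬝ᵥ a = 0 := fun a ha => by
      rw [← hs]; exact hW (Submodule.subset_span ha)
    rcases le_total 0 (s ⬝ᵥ x) with h | h
    · exact ⟨s, hs0, fun a ha => by rw [hsA a ha]; exact h⟩
    · refine ⟨-s, neg_ne_zero.2 hs0, fun a ha => ?_⟩
      rw [neg_dotProduct, neg_dotProduct, hsA a ha]
      linarith

/-- Gordan's theorem: if no nontrivial nonnegative combination of finitely many vectors vanishes,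
then some vector has a positive product with all of them. -/
theorem exists_forall_dotProduct_pos {ι : Type*} [Fintype ι] (v : ι → E → ℝ)
    (hv : ∀ a : ι → ℝ, (∀ i, 0 ≤ a i) → ∑ i, a i • v i = 0 → ∀ i, a i = 0) :
    ∃ w : E → ℝ, ∀ i, 0 < w ⬝ᵥ v i := by
  classical
  have hK : IsCompact (convexHull ℝ (Set.range v)) := (Set.finite_range v).isCompact_convexHull ℝ
  have h0 : (0 : E → ℝ) ∉ convexHull ℝ (Set.range v) := by
    intro h
    rw [convexHull_range_eq_exists_affineCombination] at h
    obtain ⟨s, w, hw0, hw1, hw⟩ := h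
    rw [Finset.affineCombination_eq_linear_combination _ _ _ hw1] at hw
    have := hv (fun i => if i ∈ s then w i else 0)
      (fun i => by split_ifs with hi; exacts [hw0 i hi, le_rfl])
      (by simpa [ite_smul, Finset.sum_ite_mem] using hw)
    have h1 : ∑ i ∈ s, w i = 0 := Finset.sum_eq_zero fun i hi => by simpa [hi] using this i
    rw [hw1] at h1
    exact one_ne_zero h1
  obtain ⟨f, u, hu, hf⟩ := geometric_hahn_banach_point_closed (convex_convexHull ℝ _)
    hK.isClosed h0
  obtain ⟨s, hs⟩ := exists_dotProduct_eq f.toLinearMap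
  refine ⟨s, fun i => ?_⟩
  rw [← hs]
  have := hf (v i) (subset_convexHull ℝ _ ⟨i, rfl⟩)
  rw [map_zero] at hu
  exact hu.trans this

end Separation

/-! ### Signed circuits, regular orthogonal pairs and their bases -/

section RegularPair

variable {E : Type*}

/-- The support of `c` is contained in that of `u`, and the signs agree on it. -/
def ConformsTo (c u : E → ℝ) : Prop := ∀ e, c e ≠ 0 → 0 < c e * u e

/-- The vectors whose positive entries lie in `pos` and whose negative entries lie in `neg`. -/
def InOrthant (pos neg : E → Prop) (t : E → ℝ) : Prop :=
  ∀ e, (0 < t e → pos e) ∧ (t e < 0 → neg e)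

/-- The elementary vectors with entries `0, ±1` of a subspace. -/
structure IsSignedCircuit (U : Submodule ℝ (E → ℝ)) (c : E → ℝ) : Prop where
  mem : c ∈ U
  ne_zero : c ≠ 0
  values : ∀ e, c e = 0 ∨ c e = 1 ∨ c e = -1
  elementary : ∀ u ∈ U, (∀ e, c e = 0 → u e = 0) → ∃ a : ℝ, u = a • c

/-- Every nonzero vector of the subspace conforms to a signed circuit. -/
def HasConformalCircuits (U : Submodule ℝ (E → ℝ)) : Prop :=
  ∀ u ∈ U, u ≠ 0 → ∃ c, IsSignedCircuit U c ∧ ConformsTo c u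

/-- The vectors supported in the set of coordinates form an independent set of the matroid. -/
def IsIndep (U : Submodule ℝ (E → ℝ)) (F : Set E) : Prop :=
  ∀ u ∈ U, (∀ e, e ∉ F → u e = 0) → u = 0

/-- Bases of the matroid of a pair of orthogonal subspaces. -/
def IsBase (U Us : Submodule ℝ (E → ℝ)) (T : Set E) : Prop :=
  IsIndep U T ∧ IsIndep Us Tᶜ

theorem IsBase.symm {U Us : Submodule ℝ (E → ℝ)} {T : Set E} (h : IsBase U Us T) :
    IsBase Us U Tᶜ :=
  ⟨h.2, by rw [compl_compl]; exact h.1⟩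

namespace IsSignedCircuit

variable {U : Submodule ℝ (E → ℝ)} {c d : E → ℝ}

theorem neg (h : IsSignedCircuit U c) : IsSignedCircuit U (-c) where
  mem := U.neg_mem h.mem
  ne_zero := neg_ne_zero.2 h.ne_zero
  values e := by
    rcases h.values e with h | h | h <;> simp [h]
  elementary u hu hc := by
    obtain ⟨a, ha⟩ := h.elementary u hu fun e he => hc e (by simp [he])
    exact ⟨-a, by simp [ha]⟩

theorem exists_ne_zero (h : IsSignedCircuit U c) : ∃ e, c e ≠ 0 := Function.ne_iff.1 h.ne_zero

theorem eq_or_eq_neg (hc : IsSignedCircuit U c) (hd : IsSignedCircuit U d)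
    (hs : ∀ e, c e = 0 → d e = 0) : d = c ∨ d = -c := by
  obtain ⟨a, rfl⟩ := hc.elementary d hd.mem hs
  obtain ⟨e, he⟩ := hd.exists_ne_zero
  have h1 := hd.values e
  rcases hc.values e with h | h | h <;> simp [h] at he h1 <;> rcases h1 with h1 | h1 | h1 <;>
    first
    | exact absurd h1 he
    | (left; rw [h1, one_smul])
    | (right; rw [h1, neg_one_smul])
    | (right; rw [show a = -1 by linarith, neg_one_smul])

end IsSignedCircuit

theorem ConformsTo.eq_of_isSignedCircuit {U : Submodule ℝ (E → ℝ)} {c d : E → ℝ}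
    (hc : IsSignedCircuit U c) (hd : IsSignedCircuit U d) (h : ConformsTo d c) : d = c := by
  rcases hc.eq_or_eq_neg hd fun e he => by
    by_contra hne
    have := h e hne
    simp [he] at this with h1 | h1
  · exact h1
  · obtain ⟨e, he⟩ := hd.exists_ne_zero
    have := h e he
    rw [h1] at this
    simp only [Pi.neg_apply] at this
    nlinarith [mul_self_nonneg (c e)]

theorem ConformsTo.ne_zero {c u : E → ℝ} (h : ConformsTo c u) {e : E} (he : c e ≠ 0) :
    u e ≠ 0 := fun h0 => by
  have := h e he
  simp [h0] at this

variable [Fintype E]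

/-- Mutually orthogonal subspaces, both of them regular. -/
structure IsRegularPair (U Us : Submodule ℝ (E → ℝ)) : Prop where
  mem_left_iff : ∀ u, u ∈ U ↔ ∀ s ∈ Us, u ⬝ᵥ s = 0
  mem_right_iff : ∀ s, s ∈ Us ↔ ∀ u ∈ U, s ⬝ᵥ u = 0
  left : HasConformalCircuits U
  right : HasConformalCircuits Us

theorem IsRegularPair.symm {U Us : Submodule ℝ (E → ℝ)} (h : IsRegularPair U Us) :
    IsRegularPair Us U :=
  ⟨h.mem_right_iff, h.mem_left_iff, h.right, h.left⟩

theorem IsRegularPair.dotProduct_eq_zero {U Us : Submodule ℝ (E → ℝ)} (h : IsRegularPair U Us)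
    {u s : E → ℝ} (hu : u ∈ U) (hs : s ∈ Us) : u ⬝ᵥ s = 0 :=
  (h.mem_left_iff u).1 hu s hs

section Conformal

variable {U : Submodule ℝ (E → ℝ)}

/-- A conforming circuit with positive product can be subtracted until a coordinate of `u` vanishes.
The remainder conforms to `u`, has smaller support and a negative product, so it is nonzero and
induction applies. This turns a Farkas certificate into a single circuit. -/
theorem HasConformalCircuits.exists_dotProduct_nonpos (hU : HasConformalCircuits U) (p : E → ℝ)
    {u : E → ℝ} (hu : u ∈ U) (hu0 : u ≠ 0) (hp : p ⬝ᵥ u ≤ 0) :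
    ∃ c, IsSignedCircuit U c ∧ ConformsTo c u ∧ p ⬝ᵥ c ≤ 0 := by
  induction hn : (Function.support u).ncard using Nat.strong_induction_on generalizing u with
  | _ n ih =>
  obtain ⟨d, hd, hdu⟩ := hU u hu hu0
  by_cases hpd : p ⬝ᵥ d ≤ 0
  · exact ⟨d, hd, hdu, hpd⟩
  push Not at hpd
  obtain ⟨e₀, he₀, hmin⟩ := Set.exists_min_image (Function.support d) (fun e => |u e|)
    (Set.toFinite _) hd.exists_ne_zero
  have ha : 0 < |u e₀| := abs_pos.2 (hdu.ne_zero he₀)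
  set a := |u e₀| with hadef
  have hval : ∀ e, d e = 0 ∨ (d e = 1 ∧ a ≤ u e) ∨ (d e = -1 ∧ u e ≤ -a) := by
    intro e
    rcases hd.values e with h | h | h
    · exact Or.inl h
    · have h1 := hmin e (by simp [h])
      have h2 := hdu e (by simp [h])
      rw [h, one_mul] at h2
      rw [abs_of_pos h2] at h1
      exact Or.inr (Or.inl ⟨h, h1⟩)
    · have h1 := hmin e (by simp [h])
      have h2 := hdu e (by simp [h])
      have h3 : u e < 0 := by rw [h] at h2; linarith
      rw [abs_of_neg h3] at h1
      exact Or.inr (Or.inr ⟨h, by linarith⟩)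
  have hp' : p ⬝ᵥ (u - a • d) < 0 := by
    rw [dotProduct_sub, dotProduct_smul, smul_eq_mul]
    nlinarith
  have hsub : Function.support (u - a • d) ⊂ Function.support u := by
    refine ⟨fun e he => ?_, fun h => ?_⟩
    · rcases hval e with h | ⟨h, h1⟩ | ⟨h, h1⟩
      · simpa [h] using he
      · exact (lt_of_lt_of_le ha h1).ne'
      · exact (lt_of_le_of_lt h1 (neg_lt_zero.2 ha)).ne
    · apply h (show e₀ ∈ Function.support u from hdu.ne_zero he₀)
      have h2 : 0 < d e₀ * u e₀ := hdu e₀ he₀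
      rcases hd.values e₀ with h | h | h
      · exact absurd h he₀
      · rw [h, one_mul] at h2
        simp [hadef, h, abs_of_pos h2]
      · have h3 : u e₀ < 0 := by rw [h] at h2; linarith
        simp [hadef, h, abs_of_neg h3]
  have hne : u - a • d ≠ 0 := by
    intro h
    rw [h, dotProduct_zero] at hp'
    exact hp'.false
  obtain ⟨c, hc, hcu, hpc⟩ := ih _ (hn ▸ Set.ncard_lt_ncard hsub (Set.toFinite _))
    (U.sub_mem hu (U.smul_mem a hd.mem)) hne hp'.le rfl
  refine ⟨c, hc, fun e he => ?_, hpc⟩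
  have h1 := hcu e he
  simp only [Pi.sub_apply, Pi.smul_apply, smul_eq_mul] at h1
  rcases hc.values e with h2 | h2 | h2
  · exact absurd h2 he
  · rw [h2] at h1 ⊢
    rcases hval e with h | ⟨h, h3⟩ | ⟨h, h3⟩ <;> rw [h] at h1 <;> linarith
  · rw [h2] at h1 ⊢
    rcases hval e with h | ⟨h, h3⟩ | ⟨h, h3⟩ <;> rw [h] at h1 <;> linarith

/-- A `{0, ±1}`-vector of a regular subspace is a sum of disjoint signed circuits. -/
theorem HasConformalCircuits.exists_disjoint_sum (hU : HasConformalCircuits U) {u : E → ℝ}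
    (hu : u ∈ U) (hval : ∀ e, u e = 0 ∨ u e = 1 ∨ u e = -1) :
    ∃ J : Finset (E → ℝ), (∀ c ∈ J, IsSignedCircuit U c ∧ ConformsTo c u) ∧
      (∀ c ∈ J, ∀ d ∈ J, c ≠ d → Disjoint (Function.support c) (Function.support d)) ∧
      u = ∑ c ∈ J, c := by
  classical
  induction hn : (Function.support u).ncard using Nat.strong_induction_on generalizing u with
  | _ n ih =>
  by_cases hu0 : u = 0
  · exact ⟨∅, by simp, by simp, by simpa using hu0⟩
  obtain ⟨d, hd, hdu⟩ := hU u hu hu0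
  have hsplit : ∀ e, (d e = 0 ∧ (u - d) e = u e) ∨ (d e = u e ∧ d e ≠ 0 ∧ (u - d) e = 0) := by
    intro e
    by_cases hde : d e = 0
    · exact Or.inl ⟨hde, by simp [hde]⟩
    have h := hdu e hde
    have h1 : d e = u e := by
      rcases hd.values e with h1 | h1 | h1 <;> rcases hval e with h2 | h2 | h2 <;>
        rw [h1, h2] at h ⊢ <;> norm_num at h
    exact Or.inr ⟨h1, hde, by simp [h1]⟩
  have hsub : Function.support (u - d) ⊂ Function.support u := by
    refine ⟨fun e he => ?_, fun h => ?_⟩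
    · rcases hsplit e with h | h
      · rwa [Function.mem_support, h.2] at he
      · exact absurd h.2.2 he
    · obtain ⟨e, he⟩ := hd.exists_ne_zero
      rcases hsplit e with h1 | h1
      · exact he h1.1
      · exact h (show e ∈ Function.support u by
          rw [Function.mem_support, ← h1.1]; exact h1.2.1) h1.2.2
  obtain ⟨J, hJ, hdisj, hsum⟩ := ih _ (hn ▸ Set.ncard_lt_ncard hsub (Set.toFinite _))
    (U.sub_mem hu hd.mem) (fun e => by
      rcases hsplit e with h | h
      · rw [h.2]; exact hval e
      · exact Or.inl h.2.2) rfl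
  have hdJ : ∀ c ∈ J, Disjoint (Function.support d) (Function.support c) := by
    intro c hc
    rw [Set.disjoint_left]
    intro e hde hce
    rcases hsplit e with h | h
    · exact hde h.1
    · exact (hJ c hc).2.ne_zero hce h.2.2
  have hdn : d ∉ J := fun h => by
    obtain ⟨e, he⟩ := hd.exists_ne_zero
    exact Set.disjoint_left.1 (hdJ d h) he he
  refine ⟨insert d J, ?_, ?_, ?_⟩
  · intro c hc
    rcases Finset.mem_insert.1 hc with rfl | hc
    · exact ⟨hd, hdu⟩
    · refine ⟨(hJ c hc).1, fun e he => ?_⟩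
      have h1 := (hJ c hc).2 e he
      rcases hsplit e with h | h
      · rwa [h.2] at h1
      · rw [h.2.2, mul_zero] at h1
        exact absurd h1 (lt_irrefl _)
  · intro c hc c' hc' hne
    rw [Finset.mem_insert] at hc hc'
    rcases hc with hc | hc <;> rcases hc' with hc' | hc'
    · exact absurd (hc.trans hc'.symm) hne
    · exact hc ▸ hdJ c' hc'
    · exact hc' ▸ (hdJ c hc).symm
    · exact hdisj c hc c' hc' hne
  · rw [Finset.sum_insert hdn, ← hsum]
    abel

end Conformal

section Bases

variable {U Us : Submodule ℝ (E → ℝ)} {T : Set E}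

/-- Otherwise some `s` separates `r` from `U` plus the vectors supported in `T`. Such an `s` lies in
`Us` and is supported off `T`, hence is zero. -/
theorem IsRegularPair.exists_eq_off (h : IsRegularPair U Us) (hT : IsBase U Us T) (r : E → ℝ) :
    ∃ u ∈ U, ∀ e, e ∉ T → u e = r e := by
  classical
  have hr : r ∈ U ⊔ Submodule.pi Tᶜ (fun _ => (⊥ : Submodule ℝ ℝ)) := by
    by_contra hr
    obtain ⟨s, hs, hs0⟩ := exists_dotProduct_ne_zero hr
    apply hs
    have : s = 0 := by
      refine hT.2 s ((h.mem_right_iff s).2 fun u hu => hs0 u (Submodule.mem_sup_left hu)) ?_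
      intro e he
      have := hs0 (Pi.single e 1) (Submodule.mem_sup_right (by
        rw [Submodule.mem_pi]
        intro f hf
        have : f ≠ e := by
          rintro rfl
          exact he hf
        simp [this]))
      simpa using this
    rw [this, zero_dotProduct]
  obtain ⟨u, hu, v, hv, rfl⟩ := Submodule.mem_sup.1 hr
  refine ⟨u, hu, fun e he => ?_⟩
  have := Submodule.mem_pi.1 hv e he
  simp only [Submodule.mem_bot] at this
  simp [this]

/-- For `T` maximal independent, a nonzero `s ∈ Us` supported off `T` would meet the circuit created
by adding a point `e` of its support in `e` alone, against orthogonality. -/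
theorem IsRegularPair.exists_isBase_superset (h : IsRegularPair U Us) {F : Set E}
    (hF : IsIndep U F) : ∃ T, F ⊆ T ∧ IsBase U Us T := by
  obtain ⟨T, hFT, hT⟩ := (Set.toFinite {T : Set E | IsIndep U T}).exists_le_maximal hF
  refine ⟨T, hFT, hT.prop, fun s hs hsT => ?_⟩
  by_contra hs0
  obtain ⟨e, he⟩ := Function.ne_iff.1 hs0
  have heT : e ∉ T := fun h1 => he (hsT e (fun h2 => h2 h1))
  have hnot : ¬ IsIndep U (insert e T) := fun h1 =>
    heT (hT.le_of_ge h1 (Set.subset_insert e T) (Set.mem_insert e T))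
  unfold IsIndep at hnot
  push Not at hnot
  obtain ⟨u, hu, hue, hu0⟩ := hnot
  have hue0 : u e ≠ 0 := by
    intro h0
    refine hu0 (hT.prop u hu fun f hf => ?_)
    by_cases hfe : f = e
    · rw [hfe, h0]
    · exact hue f (by simp [hfe, hf])
  have h1 := h.dotProduct_eq_zero hu hs
  rw [dotProduct, Finset.sum_eq_single e (fun f _ hf => ?_) (by simp)] at h1
  · exact mul_ne_zero hue0 he h1
  · by_cases hfT : f ∈ T
    · rw [hsT f (fun h2 => h2 hfT), mul_zero]
    · rw [hue f (by simp [hf, hfT]), zero_mul]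

theorem IsRegularPair.exists_fundamental (h : IsRegularPair U Us) (hT : IsBase U Us T) {e : E}
    (he : e ∉ T) : ∃ c, IsSignedCircuit U c ∧ c e ≠ 0 ∧ ∀ f, f ∉ T → f ≠ e → c f = 0 := by
  classical
  obtain ⟨u, hu, hue⟩ := h.exists_eq_off hT (Pi.single e 1)
  have hu0 : u ≠ 0 := fun h0 => by simpa [h0] using hue e he
  obtain ⟨c, hc, hcu⟩ := h.left u hu hu0
  have hoff : ∀ f, f ∉ T → f ≠ e → c f = 0 := fun f hf hfe => by
    by_contra hne
    exact hcu.ne_zero hne (by simp [hue f hf, hfe])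
  refine ⟨c, hc, fun h0 => hc.ne_zero (hT.1 c hc.mem fun f hf => ?_), hoff⟩
  by_cases hfe : f = e
  · rw [hfe, h0]
  · exact hoff f hf hfe

/-- The functional `w` vanishes on no signed circuit; it chooses the signed circuits on which it is
positive. -/
def IsGeneric (U : Submodule ℝ (E → ℝ)) (w : E → ℝ) : Prop :=
  ∀ c, IsSignedCircuit U c → w ⬝ᵥ c ≠ 0

theorem dotProduct_eq_of_sub_mem (h : IsRegularPair U Us) {w v c : E → ℝ} (hc : c ∈ U)
    (hv : v - w ∈ Us) : w ⬝ᵥ c = v ⬝ᵥ c := by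
  have := h.symm.dotProduct_eq_zero hv hc
  rw [sub_dotProduct] at this
  linarith

theorem dotProduct_eq_single {v c : E → ℝ} {e : E} (h : ∀ f, f ≠ e → v f = 0 ∨ c f = 0) :
    v ⬝ᵥ c = v e * c e := by
  rw [dotProduct, Finset.sum_eq_single e (fun f _ hf => ?_) (by simp)]
  rcases h f hf with h | h <;> simp [h]

/-- Subtracting from `w` the vector of `Us` that agrees with it on `T` gives `τ`. For the
fundamental circuit `c` of `e`, the product of `w` and `c` is `τ e * c e`, so genericity makes `τ e`
nonzero. -/
theorem IsRegularPair.exists_representative_off (h : IsRegularPair U Us) {w : E → ℝ}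
    (hw : IsGeneric U w) (hT : IsBase U Us T) :
    ∃ τ, τ - w ∈ Us ∧ (∀ e, e ∈ T → τ e = 0) ∧ ∀ e, e ∉ T → τ e ≠ 0 := by
  obtain ⟨s, hs, hsw⟩ := h.symm.exists_eq_off hT.symm w
  have hτ : w - s - w ∈ Us := by
    rw [sub_sub_cancel_left]
    exact Us.neg_mem hs
  have hT0 : ∀ e, e ∈ T → (w - s) e = 0 := fun e he => by
    simp [hsw e (fun h1 => h1 he)]
  refine ⟨w - s, hτ, hT0, fun e he h0 => ?_⟩
  obtain ⟨c, hc, -, hc0⟩ := h.exists_fundamental hT he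
  apply hw c hc
  rw [dotProduct_eq_of_sub_mem h hc.mem hτ, dotProduct_eq_single (e := e), h0, zero_mul]
  intro f hf
  by_cases hfT : f ∈ T
  · exact Or.inl (hT0 f hfT)
  · exact Or.inr (hc0 f hfT hf)

/-- The representative `t` of `ws` modulo `U` that is supported in the base `T`, and the
representative `τ` of `w` modulo `Us` that is supported off `T`.  Their signs are the directions of
the edges in the chosen fundamental cocycles and cycles. -/
structure IsBaseData (U Us : Submodule ℝ (E → ℝ)) (w ws : E → ℝ) (T : Set E) (t τ : E → ℝ) :
    Prop where
  isBase : IsBase U Us T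
  sub_mem_left : t - ws ∈ U
  eq_zero_off : ∀ e, e ∉ T → t e = 0
  ne_zero_on : ∀ e, e ∈ T → t e ≠ 0
  sub_mem_right : τ - w ∈ Us
  eq_zero_on : ∀ e, e ∈ T → τ e = 0
  ne_zero_off : ∀ e, e ∉ T → τ e ≠ 0

omit [Fintype E] in
theorem IsBaseData.symm {w ws t τ : E → ℝ} (h : IsBaseData U Us w ws T t τ) :
    IsBaseData Us U ws w Tᶜ τ t where
  isBase := h.isBase.symm
  sub_mem_left := h.sub_mem_right
  eq_zero_off e he := h.eq_zero_on e (not_not.1 he)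
  ne_zero_on := h.ne_zero_off
  sub_mem_right := h.sub_mem_left
  eq_zero_on := h.eq_zero_off
  ne_zero_off e he := h.ne_zero_on e (not_not.1 he)

theorem IsBase.exists_isBaseData (hT : IsBase U Us T) (h : IsRegularPair U Us) {w ws : E → ℝ}
    (hw : IsGeneric U w) (hws : IsGeneric Us ws) : ∃ t τ, IsBaseData U Us w ws T t τ := by
  obtain ⟨τ, h1, h2, h3⟩ := h.exists_representative_off hw hT
  obtain ⟨t, h4, h5, h6⟩ := h.symm.exists_representative_off hws hT.symm
  exact ⟨t, τ, hT, h4, h5, fun e he => h6 e (fun h7 => h7 he), h1, h2, h3⟩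

end Bases

end RegularPair

/-! ### Linear programming over an orthant -/

section Orthant

variable {E : Type*} [Fintype E] {U Us : Submodule ℝ (E → ℝ)} {w ws : E → ℝ}
  {pos neg : E → Prop}

omit [Fintype E] in
theorem InOrthant.smul {t : E → ℝ} (h : InOrthant pos neg t) {a : ℝ} (ha : 0 ≤ a) :
    InOrthant pos neg (a • t) := by
  intro e
  simp only [Pi.smul_apply, smul_eq_mul]
  exact ⟨fun h1 => (h e).1 (pos_of_mul_pos_right h1 ha),
    fun h1 => (h e).2 (neg_of_mul_neg_right h1 ha)⟩

omit [Fintype E] in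
theorem InOrthant.add {t s : E → ℝ} (ht : InOrthant pos neg t) (hs : InOrthant pos neg s) :
    InOrthant pos neg (t + s) := by
  intro e
  simp only [Pi.add_apply]
  refine ⟨fun h => ?_, fun h => ?_⟩
  · by_cases h1 : 0 < t e
    · exact (ht e).1 h1
    · exact (hs e).1 (by linarith)
  · by_cases h1 : t e < 0
    · exact (ht e).2 h1
    · exact (hs e).2 (by linarith)

/-- A form of Farkas' lemma in terms of the signed circuits of the orthogonal subspace. -/
theorem IsRegularPair.exists_inOrthant (h : IsRegularPair U Us)
    (hd : ∀ d, IsSignedCircuit Us d → (∀ e, (0 < d e → ¬ neg e) ∧ (d e < 0 → ¬ pos e)) →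
      0 < ws ⬝ᵥ d) :
    ∃ t, t - ws ∈ U ∧ InOrthant pos neg t := by
  classical
  by_contra hcon
  push Not at hcon
  -- The convex cone of all right-hand sides for which the problem is feasible. A vector separating
  -- `ws` from it is, up to sign, an element of `Us`, and a circuit conforming to that element
  -- violates `hd`.
  let A : Set (E → ℝ) := {x | ∃ t, t - x ∈ U ∧ InOrthant pos neg t}
  have hsmul : ∀ a : ℝ, 0 ≤ a → ∀ x ∈ A, a • x ∈ A := by
    rintro a ha x ⟨t, ht, hto⟩
    exact ⟨a • t, by rw [← smul_sub]; exact U.smul_mem a ht, hto.smul ha⟩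
  have hadd : ∀ x ∈ A, ∀ y ∈ A, x + y ∈ A := by
    rintro x ⟨t, ht, hto⟩ y ⟨s, hs, hso⟩
    exact ⟨t + s, by rw [add_sub_add_comm]; exact U.add_mem ht hs, hto.add hso⟩
  have hA : Convex ℝ A := fun x hx y hy a b ha hb _ =>
    hadd _ (hsmul a ha x hx) _ (hsmul b hb y hy)
  have h0 : (0 : E → ℝ) ∈ A := ⟨0, by simp, fun e => by simp⟩
  have hws : ws ∉ A := fun ⟨t, ht, hto⟩ => hcon t ht hto
  obtain ⟨s, hs0, hs⟩ := exists_ne_zero_forall_dotProduct_le hA h0 hws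
  have hs' : ∀ a ∈ A, s ⬝ᵥ a ≤ 0 := by
    intro a ha
    by_contra hpos
    push Not at hpos
    have h1 := hs 0 h0
    rw [dotProduct_zero] at h1
    -- This multiple of `a` has product `s ⬝ᵥ ws + 1`, above the bound.
    have h2 := hs _ (hsmul ((s ⬝ᵥ ws + 1) / (s ⬝ᵥ a)) (by positivity) a ha)
    rw [dotProduct_smul, smul_eq_mul, div_mul_cancel₀ _ hpos.ne'] at h2
    linarith
  have hsU : -s ∈ Us := by
    rw [h.mem_right_iff]
    intro u hu
    have h1 := hs' u ⟨0, by simpa using hu, fun e => by simp⟩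
    have h2 := hs' (-u) ⟨0, by simpa using hu, fun e => by simp⟩
    rw [dotProduct_neg] at h2
    rw [neg_dotProduct]
    linarith
  have hws0 : ws ⬝ᵥ (-s) ≤ 0 := by
    have h1 := hs 0 h0
    rw [dotProduct_zero, dotProduct_comm] at h1
    rw [dotProduct_neg]
    linarith
  obtain ⟨d, hdc, hds, hdw⟩ := h.right.exists_dotProduct_nonpos ws hsU (neg_ne_zero.2 hs0) hws0
  refine absurd (hd d hdc fun e => ⟨fun h1 h2 => ?_, fun h1 h2 => ?_⟩) hdw.not_gt
  · have h3 := hds e h1.ne'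
    have h4 : s e < 0 := by simpa using pos_of_mul_pos_right h3 h1.le
    have h5 := hs' (Pi.single e (-1)) ⟨Pi.single e (-1), by simp, fun f => by
      by_cases hf : f = e
      · subst hf
        simpa using h2
      · simp [hf]⟩
    simp only [dotProduct_single] at h5
    linarith
  · have h3 := hds e h1.ne
    have h4 : 0 < s e := by
      simp only [Pi.neg_apply] at h3
      nlinarith
    have h5 := hs' (Pi.single e 1) ⟨Pi.single e 1, by simp, fun f => by
      by_cases hf : f = e
      · subst hf
        simpa using h2
      · simp [hf]⟩
    simp only [dotProduct_single] at h5
    linarith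

/-- Descent to a vertex. While a circuit `c` with positive `w`-value is supported on the free or
nonzero coordinates, one moves along `-c` until a non-free coordinate vanishes. By `hc` no descent
ray stays in the orthant, so some coordinate stops the move. -/
theorem InOrthant.exists_isIndep (hw : IsGeneric U w)
    (hc : ∀ c, IsSignedCircuit U c → 0 < w ⬝ᵥ c → ¬ InOrthant pos neg (-c))
    (hU : HasConformalCircuits U) {t : E → ℝ} (ht : t - ws ∈ U) (hto : InOrthant pos neg t) :
    ∃ t', t' - ws ∈ U ∧ InOrthant pos neg t' ∧ w ⬝ᵥ t' ≤ w ⬝ᵥ t ∧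
      IsIndep U {e | (pos e ∧ neg e) ∨ t' e ≠ 0} := by
  induction hn : {e | (pos e ∧ neg e) ∨ t e ≠ 0}.ncard using Nat.strong_induction_on
    generalizing t with
  | _ n ih =>
  by_cases hI : IsIndep U {e | (pos e ∧ neg e) ∨ t e ≠ 0}
  · exact ⟨t, ht, hto, le_rfl, hI⟩
  have hex : ∃ c, IsSignedCircuit U c ∧ 0 < w ⬝ᵥ c ∧
      ∀ e, c e ≠ 0 → (pos e ∧ neg e) ∨ t e ≠ 0 := by
    unfold IsIndep at hI
    push Not at hI
    obtain ⟨u, hu, hue, hu0⟩ := hI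
    obtain ⟨c, hcc, hcu⟩ := hU u hu hu0
    have hsupp : ∀ e, c e ≠ 0 → (pos e ∧ neg e) ∨ t e ≠ 0 := fun e he => by
      by_contra hne
      exact hcu.ne_zero he (hue e hne)
    rcases (hw c hcc).lt_or_gt with h1 | h1
    · exact ⟨-c, hcc.neg, by rw [dotProduct_neg]; linarith,
        fun e he => hsupp e (by simpa using he)⟩
    · exact ⟨c, hcc, h1, hsupp⟩
  obtain ⟨c, hcc, hcw, hsupp⟩ := hex
  -- The ratio test: these coordinates shrink along `-c`, and since `c` has entries `0, ±1`, the
  -- first one vanishes after the minimum of `c e * t e`.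
  have hB : {e | ¬ (pos e ∧ neg e) ∧ 0 < c e * t e}.Nonempty := by
    have h1 := hc c hcc hcw
    unfold InOrthant at h1
    push Not at h1
    obtain ⟨e, he⟩ := h1
    have hce : c e ≠ 0 := by
      intro h0
      simp [h0] at he
    have hfree : ¬ (pos e ∧ neg e) := fun h2 => by
      simp only [h2.1, h2.2] at he
      simp at he
    have hte := (hsupp e hce).resolve_left hfree
    refine ⟨e, hfree, ?_⟩
    rcases hcc.values e with h2 | h2 | h2
    · exact absurd h2 hce
    · simp only [Pi.neg_apply, h2] at he
      have h3 : ¬ neg e := (he (fun h => by norm_num at h)).2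
      have h4 : ¬ t e < 0 := fun h5 => h3 ((hto e).2 h5)
      rw [h2, one_mul]
      exact lt_of_le_of_ne (not_lt.1 h4) hte.symm
    · have h3 : ¬ pos e := fun hp => by
        have := (he (fun _ => hp)).1
        simp only [Pi.neg_apply, h2] at this
        norm_num at this
      have h4 : ¬ 0 < t e := fun h5 => h3 ((hto e).1 h5)
      have h5 := lt_of_le_of_ne (not_lt.1 h4) hte
      rw [h2]
      linarith
  obtain ⟨e₀, ⟨he₀, hpos₀⟩, hmin⟩ := Set.exists_min_image _ (fun e => c e * t e)
    (Set.toFinite _) hB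
  set a := c e₀ * t e₀ with ha
  have hto' : InOrthant pos neg (t - a • c) := by
    intro e
    by_cases hfree : pos e ∧ neg e
    · exact ⟨fun _ => hfree.1, fun _ => hfree.2⟩
    simp only [Pi.sub_apply, Pi.smul_apply, smul_eq_mul]
    have hm := fun h => hmin e ⟨hfree, h⟩
    rcases hcc.values e with h2 | h2 | h2
    · rw [h2, mul_zero, sub_zero]
      exact hto e
    · simp only [h2, one_mul] at hm ⊢
      have hte := (hsupp e (by simp [h2])).resolve_left hfree
      rcases hte.lt_or_gt with h3 | h3
      · exact ⟨fun h4 => by linarith, fun _ => (hto e).2 h3⟩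
      · exact ⟨fun _ => (hto e).1 h3, fun h4 => by linarith [hm h3]⟩
    · simp only [h2] at hm ⊢
      have hte := (hsupp e (by simp [h2])).resolve_left hfree
      rcases hte.lt_or_gt with h3 | h3
      · exact ⟨fun h4 => by linarith [hm (by linarith)], fun _ => (hto e).2 h3⟩
      · exact ⟨fun _ => (hto e).1 h3, fun h4 => by linarith⟩
  have hsub : {e | (pos e ∧ neg e) ∨ (t - a • c) e ≠ 0} ⊂ {e | (pos e ∧ neg e) ∨ t e ≠ 0} := by
    refine ⟨fun e he => ?_, fun h1 => ?_⟩
    · by_cases hce : c e = 0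
      · simpa [hce] using he
      · exact hsupp e hce
    · have hc0 : c e₀ ≠ 0 := fun h0 => by simp [ha, h0] at hpos₀
      have := (h1 (show e₀ ∈ {e | (pos e ∧ neg e) ∨ t e ≠ 0} from hsupp e₀ hc0)).resolve_left he₀
      apply this
      simp only [Pi.sub_apply, Pi.smul_apply, smul_eq_mul, ha]
      rcases hcc.values e₀ with h2 | h2 | h2
      · exact absurd h2 hc0
      · rw [h2]; ring
      · rw [h2]; ring
  obtain ⟨t', h1, h2, h3, h4⟩ := ih _ (hn ▸ Set.ncard_lt_ncard hsub (Set.toFinite _))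
    (t := t - a • c) (by
      rw [sub_right_comm]
      exact U.sub_mem ht (U.smul_mem a hcc.mem)) hto' rfl
  refine ⟨t', h1, h2, h3.trans ?_, h4⟩
  rw [dotProduct_sub, dotProduct_smul, smul_eq_mul]
  have := mul_pos hpos₀ hcw
  linarith

/-- The linear program minimising `w` on `ws + U` within the orthant: `hd` makes it feasible, `hc`
bounded. The base comes from an optimal vertex, and the condition on `τ` off `T` is the sign
condition on reduced costs. -/
theorem IsRegularPair.exists_isBaseData_inOrthant (h : IsRegularPair U Us) (hw : IsGeneric U w)
    (hws : IsGeneric Us ws)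
    (hc : ∀ c, IsSignedCircuit U c → 0 < w ⬝ᵥ c → ¬ InOrthant pos neg (-c))
    (hd : ∀ d, IsSignedCircuit Us d → (∀ e, (0 < d e → ¬ neg e) ∧ (d e < 0 → ¬ pos e)) →
      0 < ws ⬝ᵥ d) :
    ∃ T t τ, IsBaseData U Us w ws T t τ ∧ InOrthant pos neg t ∧
      (∀ e, pos e → neg e → e ∈ T) ∧
      ∀ e, e ∉ T → (0 < τ e → ¬ neg e) ∧ (τ e < 0 → ¬ pos e) := by
  let K : Set (E → ℝ) := {t | t - ws ∈ U ∧ InOrthant pos neg t ∧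
    IsIndep U {e | (pos e ∧ neg e) ∨ t e ≠ 0}}
  -- A vertex is determined by its set of free or nonzero coordinates, since that set is
  -- independent.
  have hKfin : K.Finite := by
    refine Set.Finite.of_finite_image
      (f := fun t : E → ℝ => {e | (pos e ∧ neg e) ∨ t e ≠ 0}) (Set.toFinite _) ?_
    intro t ht t' ht' heq
    have h1 : t - t' = 0 := by
      refine ht.2.2 _ (by simpa using U.sub_mem ht.1 ht'.1) fun e he => ?_
      have he' : e ∉ {e | (pos e ∧ neg e) ∨ t' e ≠ 0} := by
        rwa [← show _ = {e | (pos e ∧ neg e) ∨ t' e ≠ 0} from heq]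
      simp only [Set.mem_ofPred_eq, not_or, not_not] at he he'
      simp [he.2, he'.2]
    exact sub_eq_zero.1 h1
  have hred : ∀ t, t - ws ∈ U → InOrthant pos neg t → ∃ t' ∈ K, w ⬝ᵥ t' ≤ w ⬝ᵥ t := by
    intro t ht hto
    obtain ⟨t', h1, h2, h3, h4⟩ := InOrthant.exists_isIndep hw hc h.left ht hto
    exact ⟨t', ⟨h1, h2, h4⟩, h3⟩
  have hKne : K.Nonempty := by
    obtain ⟨t, ht, hto⟩ := h.exists_inOrthant hd
    obtain ⟨t', ht', -⟩ := hred t ht hto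
    exact ⟨t', ht'⟩
  obtain ⟨t, htK, hmin⟩ := Set.exists_min_image K (fun t => w ⬝ᵥ t) hKfin hKne
  have hmin' : ∀ s, s - ws ∈ U → InOrthant pos neg s → w ⬝ᵥ t ≤ w ⬝ᵥ s := by
    intro s hs hso
    obtain ⟨s', hs', hle⟩ := hred s hs hso
    exact (hmin s' hs').trans hle
  obtain ⟨htU, hto, hind⟩ := htK
  obtain ⟨T, hPT, hT⟩ := h.exists_isBase_superset hind
  have htoff : ∀ e, e ∉ T → t e = 0 := fun e he => by
    by_contra hne
    exact he (hPT (Or.inr hne))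
  -- Genericity of `ws` makes the vertex nondegenerate: `t`, being the representative supported in
  -- `T`, vanishes nowhere on `T`.
  obtain ⟨t₁, τ, hdata⟩ := hT.exists_isBaseData h hw hws
  obtain rfl : t = t₁ := by
    have : t - t₁ = 0 := by
      refine hT.1 _ (by simpa using U.sub_mem htU hdata.sub_mem_left) fun e he => ?_
      simp [htoff e he, hdata.eq_zero_off e he]
    exact sub_eq_zero.1 this
  refine ⟨T, t, τ, hdata, hto, fun e h1 h2 => hPT (Or.inl ⟨h1, h2⟩), fun e he => ?_⟩
  have hex : ∃ c, IsSignedCircuit U c ∧ 0 < w ⬝ᵥ c ∧ c e ≠ 0 ∧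
      ∀ f, f ∉ T → f ≠ e → c f = 0 := by
    obtain ⟨c, hcc, hce, hcf⟩ := h.exists_fundamental hT he
    rcases (hw c hcc).lt_or_gt with h1 | h1
    · exact ⟨-c, hcc.neg, by rw [dotProduct_neg]; linarith, by simpa using hce,
        fun f hf hfe => by simp [hcf f hf hfe]⟩
    · exact ⟨c, hcc, h1, hce, hcf⟩
  obtain ⟨c, hcc, hcw, hce, hcf⟩ := hex
  have hτc : 0 < τ e * c e := by
    rw [← dotProduct_eq_single (v := τ) (c := c) (e := e),
      ← dotProduct_eq_of_sub_mem h hcc.mem hdata.sub_mem_right]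
    · exact hcw
    · intro f hf
      by_cases hfT : f ∈ T
      · exact Or.inl (hdata.eq_zero_on f hfT)
      · exact Or.inr (hcf f hfT hf)
  obtain ⟨a, ha, hat⟩ : ∃ a : ℝ, 0 < a ∧ ∀ f, f ∈ T → a < |t f| := by
    have h1 : ∀ᶠ a : ℝ in nhdsWithin 0 (Set.Ioi 0), ∀ f, f ∈ T → a < |t f| := by
      refine Filter.eventually_all.2 fun f => ?_
      by_cases hf : f ∈ T
      · have := Ioo_mem_nhdsGT (abs_pos.2 (hdata.ne_zero_on f hf))
        filter_upwards [this] with a ha _ using ha.2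
      · exact Filter.Eventually.of_forall fun a h => absurd h hf
    obtain ⟨a, h2, h3⟩ := (h1.and self_mem_nhdsWithin).exists
    exact ⟨a, h3, h2⟩
  -- A short step along the fundamental circuit lowers `w`, so it leaves the orthant. On `T` it
  -- preserves the signs of `t`, so the violation is at `e`.
  have hcon : ¬ ((0 < t e - a * c e → pos e) ∧ (t e - a * c e < 0 → neg e)) := by
    intro hee
    have hle := hmin' (t - a • c) (by
      rw [sub_right_comm]
      exact U.sub_mem htU (U.smul_mem a hcc.mem)) (by
      intro f
      simp only [Pi.sub_apply, Pi.smul_apply, smul_eq_mul]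
      by_cases hfe : f = e
      · subst hfe
        exact hee
      by_cases hfT : f ∈ T
      · have h1 := hat f hfT
        have h2 : |a * c f| ≤ a := by
          rw [abs_mul, abs_of_pos ha]
          rcases hcc.values f with h3 | h3 | h3 <;> rw [h3] <;> simp [ha.le]
        have h3 := abs_le.1 h2
        rcases lt_abs.1 h1 with h4 | h4
        · exact ⟨fun _ => (hto f).1 (by linarith), fun h5 => by linarith⟩
        · exact ⟨fun h5 => by linarith, fun _ => (hto f).2 (by linarith)⟩
      · rw [hcf f hfT hfe, mul_zero, sub_zero]
        exact hto f)
    rw [dotProduct_sub, dotProduct_smul, smul_eq_mul] at hle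
    have := mul_pos ha hcw
    linarith
  rw [htoff e he, zero_sub] at hcon
  refine ⟨fun h1 h2 => hcon ?_, fun h1 h2 => hcon ?_⟩
  · have h3 : 0 < a * c e := mul_pos ha (pos_of_mul_pos_right hτc h1.le)
    exact ⟨fun h4 => by linarith, fun _ => h2⟩
  · have h3 : a * c e < 0 := mul_neg_of_pos_of_neg ha (by nlinarith)
    exact ⟨fun _ => h2, fun h4 => by linarith⟩

end Orthant

/-! ### Half-open cells: compatibility, disjointness, covering -/

section Cells

variable {E : Type*}

theorem mem_cube {x : E → ℝ} : x ∈ cube E ↔ ∀ e, 0 ≤ x e ∧ x e ≤ 1 := by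
  rw [cube, Set.mem_Icc, Pi.le_def, Pi.le_def]
  exact ⟨fun h e => ⟨h.1 e, h.2 e⟩, fun h => ⟨fun e => (h e).1, fun e => (h e).2⟩⟩

theorem IsOrientation.mem_cube {O : E → ℝ} (hO : IsOrientation O) : O ∈ cube E :=
  OrientedGraph.mem_cube.2 fun e => by rcases hO e with h | h <;> norm_num [h]

/-- Vectors with integral coordinates. -/
def IsIntegralVec (c : E → ℝ) : Prop := ∀ e, ∃ k : ℤ, c e = k

theorem IsIntegralVec.sub {c d : E → ℝ} (hc : IsIntegralVec c) (hd : IsIntegralVec d) :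
    IsIntegralVec (c - d) := fun e => by
  obtain ⟨k, hk⟩ := hc e
  obtain ⟨l, hl⟩ := hd e
  exact ⟨k - l, by simp [hk, hl]⟩

theorem IsIntegralVec.add {c d : E → ℝ} (hc : IsIntegralVec c) (hd : IsIntegralVec d) :
    IsIntegralVec (c + d) := fun e => by
  obtain ⟨k, hk⟩ := hc e
  obtain ⟨l, hl⟩ := hd e
  exact ⟨k + l, by simp [hk, hl]⟩

theorem isIntegralVec_zero : IsIntegralVec (0 : E → ℝ) := fun _ => ⟨0, by simp⟩

theorem isIntegralVec_of_values {c : E → ℝ} (h : ∀ e, c e = 0 ∨ c e = 1 ∨ c e = -1) :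
    IsIntegralVec c := fun e => by
  rcases h e with h | h | h
  · exact ⟨0, by simp [h]⟩
  · exact ⟨1, by simp [h]⟩
  · exact ⟨-1, by simp [h]⟩

theorem IsOrientation.isIntegral {O : E → ℝ} (hO : IsOrientation O) : IsIntegralVec O :=
  isIntegralVec_of_values fun e => by rcases hO e with h | h <;> simp [h]

theorem IsIntegralVec.isOrientation {x : E → ℝ} (h : IsIntegralVec x) (hx : x ∈ cube E) :
    IsOrientation x := fun e => by
  obtain ⟨k, hk⟩ := h e
  have := mem_cube.1 hx e
  rw [hk] at this ⊢
  have h0 : 0 ≤ k := by exact_mod_cast this.1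
  have h1 : k ≤ 1 := by exact_mod_cast this.2
  rcases show k = 0 ∨ k = 1 by omega with rfl | rfl <;> simp

/-- An integral translation within the cube can only carry a coordinate from one end of `[0,1]` to
the other. All later sign arguments rest on this. -/
theorem IsIntegralVec.cases_of_mem_cube {x c : E → ℝ} (hc : IsIntegralVec c) (hx : x ∈ cube E)
    (hxc : x + c ∈ cube E) (e : E) :
    c e = 0 ∨ (c e = 1 ∧ x e = 0) ∨ (c e = -1 ∧ x e = 1) := by
  obtain ⟨k, hk⟩ := hc e
  have h1 := mem_cube.1 hx e
  have h2 := mem_cube.1 hxc e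
  rw [Pi.add_apply] at h2
  rw [hk] at h2 ⊢
  have h3 : (-1 : ℝ) ≤ k := by linarith
  have h4 : (k : ℝ) ≤ 1 := by linarith
  have h3' : -1 ≤ k := by exact_mod_cast h3
  have h4' : k ≤ 1 := by exact_mod_cast h4
  rcases show k = 0 ∨ k = 1 ∨ k = -1 by omega with rfl | rfl | rfl
  · simp
  · norm_num at h2 ⊢
    linarith
  · norm_num at h2 ⊢
    linarith

/-- The coordinate of an edge that is oriented according to the sign of `v`. -/
noncomputable def vertexCoord (v : ℝ) : ℝ := if 0 < v then 1 else 0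

theorem vertexCoord_of_pos {v : ℝ} (h : 0 < v) : vertexCoord v = 1 := if_pos h

theorem vertexCoord_of_neg {v : ℝ} (h : v < 0) : vertexCoord v = 0 := if_neg h.not_gt

theorem vertexCoord_eq (v : ℝ) : vertexCoord v = 0 ∨ vertexCoord v = 1 := by
  unfold vertexCoord
  split_ifs <;> simp

theorem pos_of_vertexCoord {v : ℝ} (h : vertexCoord v = 1) : 0 < v := by
  by_contra h1
  simp [vertexCoord, h1] at h

theorem neg_of_vertexCoord {v : ℝ} (h : vertexCoord v = 0) (hv : v ≠ 0) : v < 0 := by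
  by_contra h1
  rw [vertexCoord_of_pos (lt_of_le_of_ne (not_lt.1 h1) hv.symm)] at h
  exact one_ne_zero h

theorem exists_add_smul_mem_cube [Finite E] {y c : E → ℝ} (hy : y ∈ cube E)
    (h : ∀ e, (0 < c e → y e ≠ 1) ∧ (c e < 0 → y e ≠ 0)) :
    ∃ ε : ℝ, 0 < ε ∧ y + ε • c ∈ cube E := by
  have h1 : ∀ᶠ ε : ℝ in nhdsWithin 0 (Set.Ioi 0), ∀ e, 0 ≤ y e + ε * c e ∧ y e + ε * c e ≤ 1 := by
    refine Filter.eventually_all.2 fun e => ?_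
    have hye := mem_cube.1 hy e
    rcases lt_trichotomy (c e) 0 with hc | hc | hc
    · have hpos : 0 < y e / (-c e) :=
        div_pos (lt_of_le_of_ne hye.1 ((h e).2 hc).symm) (by linarith)
      filter_upwards [Ioo_mem_nhdsGT hpos] with ε hε
      have := (lt_div_iff₀ (by linarith)).1 hε.2
      constructor <;> nlinarith [hε.1]
    · exact Filter.Eventually.of_forall fun ε => by simpa [hc] using hye
    · have hpos : 0 < (1 - y e) / c e :=
        div_pos (sub_pos.2 (lt_of_le_of_ne hye.2 ((h e).1 hc))) hc
      filter_upwards [Ioo_mem_nhdsGT hpos] with ε hε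
      have := (lt_div_iff₀ hc).1 hε.2
      constructor <;> nlinarith [hε.1]
  obtain ⟨ε, h2, h3⟩ := (h1.and self_mem_nhdsWithin).exists
  exact ⟨ε, h3, mem_cube.2 fun e => by simpa using h2 e⟩

theorem arcCoord_one : arcCoord 1 = 1 := by norm_num [arcCoord]

theorem arcCoord_neg_one : arcCoord (-1) = 0 := by norm_num [arcCoord]

/-- The half-open cell of a base, whose sides are chosen by the signs of `t` and `τ`. -/
def halfOpenCell (T : Set E) (t τ : E → ℝ) : Set (E → ℝ) :=
  {x | x ∈ cube E ∧ (∀ e, e ∉ T → x e = vertexCoord (τ e)) ∧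
    ∀ e, e ∈ T → x e = vertexCoord (t e) ∨ (0 < x e ∧ x e < 1)}

theorem IsOrientation.eq_vertexCoord {T : Set E} {t τ y : E → ℝ} (hy : IsOrientation y)
    (hyT : y ∈ halfOpenCell T t τ) {e : E} (he : e ∈ T) : y e = vertexCoord (t e) := by
  rcases hyT.2.2 e he with h | h
  · exact h
  · rcases hy e with h1 | h1 <;> rw [h1] at h <;> norm_num at h

variable [Fintype E]

/-- The points of the cube that cannot be moved along a signed circuit chosen by `w`. -/
def compatPoints (U : Submodule ℝ (E → ℝ)) (w : E → ℝ) : Set (E → ℝ) :=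
  {x | x ∈ cube E ∧ ∀ c, IsSignedCircuit U c → 0 < w ⬝ᵥ c → ∀ ε : ℝ, 0 < ε → x + ε • c ∉ cube E}

/-- Every signed circuit in `y` is chosen by `w`. -/
def ContainsOnlyChosen (U : Submodule ℝ (E → ℝ)) (w y : E → ℝ) : Prop :=
  ∀ c, IsSignedCircuit U c → IsIn c y → 0 < w ⬝ᵥ c

variable {U Us : Submodule ℝ (E → ℝ)} {w ws : E → ℝ} {T T' : Set E} {t τ t' τ' : E → ℝ}

/-- The functional `w` may be replaced by `τ` on circuits. Off `T` the point sits at the end chosen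
by `τ`, so a feasible direction `c` has `τ e * c e ≤ 0` everywhere. -/
theorem IsBaseData.mem_compatPoints (h : IsBaseData U Us w ws T t τ) (hp : IsRegularPair U Us)
    {y : E → ℝ} (hy : y ∈ halfOpenCell T t τ) : y ∈ compatPoints U w := by
  refine ⟨hy.1, fun c hc hcw ε hε hmem => ?_⟩
  rw [dotProduct_eq_of_sub_mem hp hc.mem h.sub_mem_right] at hcw
  refine hcw.not_ge (Finset.sum_nonpos fun e _ => ?_)
  by_cases he : e ∈ T
  · simp [h.eq_zero_on e he]
  have h1 := mem_cube.1 hmem e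
  simp only [Pi.add_apply, Pi.smul_apply, smul_eq_mul, hy.2.1 e he] at h1
  rcases (h.ne_zero_off e he).lt_or_gt with h2 | h2
  · rw [vertexCoord_of_neg h2] at h1
    have : 0 ≤ c e := by
      by_contra h3
      nlinarith [mul_neg_of_pos_of_neg hε (not_le.1 h3)]
    nlinarith
  · rw [vertexCoord_of_pos h2] at h1
    have : c e ≤ 0 := by
      by_contra h3
      nlinarith [mul_pos hε (not_le.1 h3)]
    nlinarith

/-- The dual argument: `ws` may be replaced by `t`, and a coordinate of `T` used by `d` is not
bi-oriented, so `t` and `d` agree in sign there. -/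
theorem IsBaseData.containsOnlyChosen (h : IsBaseData U Us w ws T t τ) (hp : IsRegularPair U Us)
    (hws : IsGeneric Us ws) {y : E → ℝ} (hy : y ∈ halfOpenCell T t τ) :
    ContainsOnlyChosen Us ws y := by
  intro d hd hdy
  refine lt_of_le_of_ne ?_ (hws d hd).symm
  rw [dotProduct_eq_of_sub_mem hp.symm hd.mem h.sub_mem_left]
  refine Finset.sum_nonneg fun e _ => ?_
  by_cases he : e ∈ T
  · rcases hd.values e with h1 | h1 | h1
    · simp [h1]
    · have h2 := hdy e (by simp [h1])
      rw [h1, arcCoord_one] at h2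
      rcases hy.2.2 e he with h3 | h3
      · rw [h1, mul_one]
        exact (pos_of_vertexCoord (h3.symm.trans h2)).le
      · linarith
    · have h2 := hdy e (by simp [h1])
      rw [h1, arcCoord_neg_one] at h2
      rcases hy.2.2 e he with h3 | h3
      · rw [h1]
        linarith [neg_of_vertexCoord (h3.symm.trans h2) (h.ne_zero_on e he)]
      · linarith
  · simp [h.eq_zero_off e he]

/-- Lattice translates of the half-open cells of two bases are disjoint. -/
theorem IsBaseData.eq_of_mem (h : IsBaseData U Us w ws T t τ) (h' : IsBaseData U Us w ws T' t' τ')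
    (hp : IsRegularPair U Us) {y y' : E → ℝ} (hy : y ∈ halfOpenCell T t τ)
    (hy' : y' ∈ halfOpenCell T' t' τ') (hmem : y' - y ∈ Us) (hint : IsIntegralVec (y' - y)) :
    T = T' ∧ y = y' := by
  have hcases := hint.cases_of_mem_cube hy.1 (by simpa using hy'.1)
  have htt : t - t' ∈ U := by simpa using U.sub_mem h.sub_mem_left h'.sub_mem_left
  have hττ : τ - τ' ∈ Us := by simpa using Us.sub_mem h.sub_mem_right h'.sub_mem_right
  -- In the pairing of `t - t'` with `y' - y`, a coordinate that moves starts at the end given by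
  -- the sign of `t` and arrives at the end given by `t'`. All terms are thus nonpositive, and zero
  -- total forces `y' - y` to vanish on `T`.
  have hyy : y = y' := by
    have h0 := hp.dotProduct_eq_zero htt hmem
    have ht : ∀ e, t e * (y' - y) e ≤ 0 ∧ (t e ≠ 0 → (y' - y) e ≠ 0 → t e * (y' - y) e < 0) := by
      intro e
      by_cases he : e ∈ T
      · rcases hcases e with h1 | ⟨h1, h2⟩ | ⟨h1, h2⟩
        · simp [h1]
        · have h3 : t e < 0 := by
            rcases hy.2.2 e he with h3 | h3
            · exact neg_of_vertexCoord (h3.symm.trans h2) (h.ne_zero_on e he)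
            · linarith
          rw [h1]
          exact ⟨by linarith, fun _ _ => by linarith⟩
        · have h3 : 0 < t e := by
            rcases hy.2.2 e he with h3 | h3
            · exact pos_of_vertexCoord (h3.symm.trans h2)
            · linarith
          rw [h1]
          exact ⟨by linarith, fun _ _ => by linarith⟩
      · simp [h.eq_zero_off e he]
    have ht' : ∀ e, 0 ≤ t' e * (y' - y) e := by
      intro e
      by_cases he : e ∈ T'
      · rcases hcases e with h1 | ⟨h1, h2⟩ | ⟨h1, h2⟩
        · simp [h1]
        · have h3 : 0 < t' e := by
            have h4 : y' e = 1 := by simp only [Pi.sub_apply] at h1; linarith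
            rcases hy'.2.2 e he with h3 | h3
            · exact pos_of_vertexCoord (h3.symm.trans h4)
            · linarith
          rw [h1]
          linarith
        · have h3 : t' e < 0 := by
            have h4 : y' e = 0 := by simp only [Pi.sub_apply] at h1; linarith
            rcases hy'.2.2 e he with h3 | h3
            · exact neg_of_vertexCoord (h3.symm.trans h4) (h'.ne_zero_on e he)
            · linarith
          rw [h1]
          linarith
      · simp [h'.eq_zero_off e he]
    have hzero := (Finset.sum_eq_zero_iff_of_nonpos (fun e _ => by
      have h1 := (ht e).1
      have h2 := ht' e
      rw [Pi.sub_apply t t']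
      linarith)).1 h0
    refine (sub_eq_zero.1 (h.isBase.2 _ hmem fun e he => ?_)).symm
    by_contra hne
    have h1 := hzero e (Finset.mem_univ e)
    have h2 := (ht e).2 (h.ne_zero_on e (not_not.1 he)) hne
    have h3 := ht' e
    rw [Pi.sub_apply t t'] at h1
    linarith
  subst hyy
  refine ⟨?_, rfl⟩
  -- At an edge in exactly one base, the point sits at an end dictated both by `t` of one base and
  -- by `τ` of the other, so these agree in sign and the term of this pairing is negative.
  have h0 := hp.dotProduct_eq_zero htt hττ
  have key : ∀ {S S' : Set E} {a b a' b' : E → ℝ}, IsBaseData U Us w ws S a b →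
      IsBaseData U Us w ws S' a' b' → y ∈ halfOpenCell S a b → y ∈ halfOpenCell S' a' b' →
      ∀ e, e ∈ S → e ∉ S' → 0 < a e * b' e := by
    intro S S' a b a' b' hS hS' hyS hyS' e he he'
    have h1 := hyS'.2.1 e he'
    have h2 : y e = vertexCoord (a e) := by
      rcases hyS.2.2 e he with h3 | h3
      · exact h3
      · rcases vertexCoord_eq (b' e) with h4 | h4 <;> linarith
    rcases (hS'.ne_zero_off e he').lt_or_gt with h3 | h3
    · rw [vertexCoord_of_neg h3] at h1
      exact mul_pos_of_neg_of_neg (neg_of_vertexCoord (h2.symm.trans h1) (hS.ne_zero_on e he)) h3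
    · rw [vertexCoord_of_pos h3] at h1
      exact mul_pos (pos_of_vertexCoord (h2.symm.trans h1)) h3
  have hneg : ∀ e, (t - t') e * (τ - τ') e ≤ 0 ∧
      ((e ∈ T ∧ e ∉ T') ∨ (e ∈ T' ∧ e ∉ T) → (t - t') e * (τ - τ') e < 0) := by
    intro e
    by_cases h1 : e ∈ T <;> by_cases h2 : e ∈ T'
    · simp [h1, h2, h.eq_zero_on e h1, h'.eq_zero_on e h2]
    · have := key h h' hy hy' e h1 h2
      simp only [Pi.sub_apply, h.eq_zero_on e h1, h'.eq_zero_off e h2]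
      exact ⟨by linarith, fun _ => by linarith⟩
    · have := key h' h hy' hy e h2 h1
      simp only [Pi.sub_apply, h'.eq_zero_on e h2, h.eq_zero_off e h1]
      exact ⟨by linarith, fun _ => by linarith⟩
    · simp [h1, h2, h.eq_zero_off e h1, h'.eq_zero_off e h2]
  have hzero := (Finset.sum_eq_zero_iff_of_nonpos (fun e _ => (hneg e).1)).1 h0
  ext e
  by_contra hne
  exact ((hneg e).2 (by tauto)).ne (hzero e (Finset.mem_univ e))

theorem IsRegularPair.exists_mem_halfOpenCell (hp : IsRegularPair U Us) (hw : IsGeneric U w)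
    (hws : IsGeneric Us ws) {y : E → ℝ} (hy : y ∈ compatPoints U w)
    (hco : ContainsOnlyChosen Us ws y) :
    ∃ T t τ, IsBaseData U Us w ws T t τ ∧ y ∈ halfOpenCell T t τ := by
  obtain ⟨T, t, τ, hdata, hto, hfree, hoff⟩ := hp.exists_isBaseData_inOrthant hw hws
    -- A coordinate strictly between `0` and `1` is unconstrained, hence ends up in `T`. At an end,
    -- the sign of `t` must match that end.
    (pos := fun e => y e ≠ 0) (neg := fun e => y e ≠ 1)
    (fun c hc hcw horth => by
      obtain ⟨ε, hε, hmem⟩ := exists_add_smul_mem_cube (c := c) hy.1 fun e =>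
        ⟨fun h => (horth e).2 (by simpa using h), fun h => (horth e).1 (by simpa using h)⟩
      exact hy.2 c hc hcw ε hε hmem)
    (fun d hd hde => hco d hd fun e he => by
      rcases hd.values e with h | h | h
      · exact absurd h he
      · rw [h, arcCoord_one]
        exact not_not.1 ((hde e).1 (by rw [h]; norm_num))
      · rw [h, arcCoord_neg_one]
        exact not_not.1 ((hde e).2 (by rw [h]; norm_num)))
  refine ⟨T, t, τ, hdata, hy.1, fun e he => ?_, fun e he => ?_⟩
  · rcases (hdata.ne_zero_off e he).lt_or_gt with h | h
    · rw [vertexCoord_of_neg h]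
      exact not_not.1 ((hoff e he).2 h)
    · rw [vertexCoord_of_pos h]
      exact not_not.1 ((hoff e he).1 h)
  · have hye := mem_cube.1 hy.1 e
    rcases (hdata.ne_zero_on e he).lt_or_gt with h | h
    · have h1 := (hto e).2 h
      rw [vertexCoord_of_neg h]
      by_cases h0 : y e = 0
      · exact Or.inl h0
      · exact Or.inr ⟨lt_of_le_of_ne hye.1 (Ne.symm h0), lt_of_le_of_ne hye.2 h1⟩
    · have h1 := (hto e).1 h
      rw [vertexCoord_of_pos h]
      by_cases h0 : y e = 1
      · exact Or.inl h0
      · exact Or.inr ⟨lt_of_le_of_ne hye.1 h1.symm, lt_of_le_of_ne hye.2 h0⟩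

/-- If `x + c` could move along a circuit `d`, then `d e * c e ≤ 0` for all `e`. Orthogonality makes
the supports disjoint, so `x` itself could move along `d`. -/
theorem IsRegularPair.add_mem_compatPoints (hp : IsRegularPair U Us) {x c : E → ℝ}
    (hx : x ∈ compatPoints U w) (hc : c ∈ Us) (hint : IsIntegralVec c) (hxc : x + c ∈ cube E) :
    x + c ∈ compatPoints U w := by
  refine ⟨hxc, fun d hd hdw ε hε hmem => ?_⟩
  have hcases := hint.cases_of_mem_cube hx.1 hxc
  have hle : ∀ e, d e * c e ≤ 0 := by
    intro e
    have h1 := mem_cube.1 hmem e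
    simp only [Pi.add_apply, Pi.smul_apply, smul_eq_mul] at h1
    rcases hcases e with h | ⟨h, h2⟩ | ⟨h, h2⟩
    · simp [h]
    · rw [h, h2] at h1
      rw [h]
      by_contra h3
      nlinarith
    · rw [h, h2] at h1
      rw [h]
      by_contra h3
      nlinarith
  have h0 := hp.dotProduct_eq_zero hd.mem hc
  have hzero := (Finset.sum_eq_zero_iff_of_nonpos (fun e _ => hle e)).1 h0
  refine hx.2 d hd hdw ε hε (mem_cube.2 fun e => ?_)
  rcases mul_eq_zero.1 (hzero e (Finset.mem_univ e)) with h | h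
  · simpa [h] using mem_cube.1 hx.1 e
  · simpa [h] using mem_cube.1 hmem e

theorem exists_maximal_dotProduct (Us : Submodule ℝ (E → ℝ)) (ws : E → ℝ) (P : (E → ℝ) → Prop)
    (h0 : P 0) (hval : ∀ c, P c → ∀ e, c e = 0 ∨ c e = 1 ∨ c e = -1) :
    ∃ c ∈ Us, P c ∧ ∀ d ∈ Us, P d → ws ⬝ᵥ d ≤ ws ⬝ᵥ c := by
  have hfin : {c : E → ℝ | c ∈ Us ∧ P c}.Finite := by
    refine (Set.Finite.pi (t := fun _ : E => ({0, 1, -1} : Set ℝ))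
      fun _ => Set.toFinite _).subset fun c hc e _ => ?_
    simpa using hval c hc.2 e
  obtain ⟨c, hc, hmax⟩ := Set.exists_max_image _ (fun c => ws ⬝ᵥ c) hfin ⟨0, Us.zero_mem, h0⟩
  exact ⟨c, hc.1, hc.2, fun d hd hPd => hmax d ⟨hd, hPd⟩⟩

/-- Among the finitely many integral translations within the cube, `c` maximises `ws`. Reversing an
unchosen circuit of `x + c` would increase the value. -/
theorem IsRegularPair.exists_add_containsOnlyChosen (hp : IsRegularPair U Us)
    (hws : IsGeneric Us ws) {x : E → ℝ} (hx : x ∈ compatPoints U w) :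
    ∃ c ∈ Us, IsIntegralVec c ∧ x + c ∈ compatPoints U w ∧ ContainsOnlyChosen Us ws (x + c) := by
  obtain ⟨c, hc, ⟨hint, hxc⟩, hmax⟩ := exists_maximal_dotProduct Us ws
    (fun c => IsIntegralVec c ∧ x + c ∈ cube E) ⟨isIntegralVec_zero, by simpa using hx.1⟩
    (fun c hc e => by
      rcases hc.1.cases_of_mem_cube hx.1 hc.2 e with h | h | h
      · exact Or.inl h
      · exact Or.inr (Or.inl h.1)
      · exact Or.inr (Or.inr h.1))
  refine ⟨c, hc, hint, hp.add_mem_compatPoints hx hc hint hxc, fun d hd hdin => ?_⟩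
  by_contra hneg
  have hlt := lt_of_le_of_ne (not_lt.1 hneg) (hws d hd)
  have := hmax (c - d) (Us.sub_mem hc hd.mem) ⟨hint.sub (isIntegralVec_of_values hd.values),
    mem_cube.2 fun e => by
      have h1 := mem_cube.1 hxc e
      have h3 : (x + (c - d)) e = (x + c) e - d e := by simp; ring
      rw [h3]
      rcases hd.values e with h | h | h
      · simpa [h] using h1
      · have h2 := hdin e (by simp [h])
        rw [h, arcCoord_one] at h2
        rw [h2, h]
        norm_num
      · have h2 := hdin e (by simp [h])
        rw [h, arcCoord_neg_one] at h2
        rw [h2, h]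
        norm_num⟩
  rw [dotProduct_sub] at this
  linarith

end Cells

/-! ### Generating sets of cells -/

section StandardCells

variable {E : Type*}

/-- The generating set is intrinsic: it consists of the coordinates that vary on the cell. -/
theorem IsStandardCell.mem_iff {H : Set (E → ℝ)} {F : Set E} (h : IsStandardCell H F)
    (hne : H.Nonempty) (e : E) : e ∈ F ↔ ∃ x ∈ H, ∃ y ∈ H, x e ≠ y e := by
  classical
  obtain ⟨a, I, rfl, hoff, hon⟩ := h
  constructor
  · intro he
    obtain ⟨x, hx⟩ := hne
    have hupd : ∀ z ∈ I e, Function.update x e z ∈ Set.univ.pi I := fun z hz f _ => by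
      by_cases hf : f = e
      · subst hf
        simpa using hz
      · simpa [hf] using hx f (Set.mem_univ f)
    have hmem : (a e : ℝ) ∈ I e ∧ ∃ z ∈ I e, z ≠ (a e : ℝ) := by
      rcases hon e he with h | h <;> rw [h]
      · exact ⟨by simp, a e - 1 / 2, ⟨by linarith, by linarith⟩, by norm_num⟩
      · exact ⟨by simp, a e + 1 / 2, ⟨by linarith, by linarith⟩, by norm_num⟩
    obtain ⟨h1, z, hz, hza⟩ := hmem
    exact ⟨_, hupd z hz, _, hupd _ h1, by simpa using hza⟩
  · rintro ⟨x, hx, y, hy, hxy⟩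
    by_contra he
    have h1 := hx e (Set.mem_univ e)
    have h2 := hy e (Set.mem_univ e)
    rw [hoff e he] at h1 h2
    exact hxy ((Set.mem_singleton_iff.1 h1).trans (Set.mem_singleton_iff.1 h2).symm)

theorem IsStandardCell.unique {H : Set (E → ℝ)} {F F' : Set E} (h : IsStandardCell H F)
    (h' : IsStandardCell H F') (hne : H.Nonempty) : F = F' :=
  Set.ext fun e => (h.mem_iff hne e).trans (h'.mem_iff hne e).symm

variable {U Us : Submodule ℝ (E → ℝ)} {w ws : E → ℝ} {T T' : Set E} {t τ t' τ' : E → ℝ}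

/-- The point `x` witnesses nonemptiness. Where `c` is nonzero, the cube and its translate meet in a
single value; off `T` the coordinate is fixed; on the remaining edges of `T` the half-open interval
survives intact. -/
theorem IsBaseData.isStandardCell (h : IsBaseData U Us w ws T t τ) {x c : E → ℝ}
    (hx : x ∈ cube E) (hint : IsIntegralVec c) (hxc : x + c ∈ halfOpenCell T t τ) :
    IsStandardCell ((fun y => y - c) '' halfOpenCell T t τ ∩ cube E) {e | e ∈ T ∧ c e = 0} := by
  have hcases := hint.cases_of_mem_cube hx hxc.1
  have hI : ∀ e, ∃ (a : ℤ) (I : Set ℝ),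
      (¬ (e ∈ T ∧ c e = 0) → I = {(a : ℝ)}) ∧
      (e ∈ T ∧ c e = 0 → I = Set.Ioc ((a : ℝ) - 1) a ∨ I = Set.Ico (a : ℝ) ((a : ℝ) + 1)) ∧
      ∀ z : ℝ, z ∈ I ↔ (0 ≤ z + c e ∧ z + c e ≤ 1) ∧ (e ∉ T → z + c e = vertexCoord (τ e)) ∧
        (e ∈ T → z + c e = vertexCoord (t e) ∨ (0 < z + c e ∧ z + c e < 1)) ∧ 0 ≤ z ∧ z ≤ 1 := by
    intro e
    by_cases he : e ∈ T
    · rcases hcases e with h0 | ⟨h0, h1⟩ | ⟨h0, h1⟩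
      · rcases (h.ne_zero_on e he).lt_or_gt with h2 | h2
        · refine ⟨0, Set.Ico 0 1, by simp [he, h0], by simp, fun z => ?_⟩
          rw [vertexCoord_of_neg h2]
          simp only [he, h0, add_zero, not_true_eq_false, false_imp_iff, true_imp_iff, true_and,
            Set.mem_Ico]
          constructor
          · rintro ⟨h3, h4⟩
            refine ⟨⟨h3, h4.le⟩, ?_, h3, h4.le⟩
            rcases h3.eq_or_lt with h5 | h5
            · exact Or.inl h5.symm
            · exact Or.inr ⟨h5, h4⟩
          · rintro ⟨⟨h3, h4⟩, h5 | h5, -⟩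
            · exact ⟨h3, by linarith⟩
            · exact ⟨h3, h5.2⟩
        · refine ⟨1, Set.Ioc 0 1, by simp [he, h0], by simp, fun z => ?_⟩
          rw [vertexCoord_of_pos h2]
          simp only [he, h0, add_zero, not_true_eq_false, false_imp_iff, true_imp_iff, true_and,
            Set.mem_Ioc]
          constructor
          · rintro ⟨h3, h4⟩
            refine ⟨⟨h3.le, h4⟩, ?_, h3.le, h4⟩
            rcases h4.eq_or_lt with h5 | h5
            · exact Or.inl h5
            · exact Or.inr ⟨h3, h5⟩
          · rintro ⟨⟨h3, h4⟩, h5 | h5, -⟩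
            · exact ⟨by linarith, h4⟩
            · exact ⟨h5.1, h4⟩
      · refine ⟨0, {0}, by simp, by simp [h0], fun z => ?_⟩
        have h2 := hxc.2.2 e he
        simp only [Pi.add_apply, h0, h1, zero_add] at h2
        have h3 : vertexCoord (t e) = 1 := by
          rcases h2 with h2 | h2
          · exact h2.symm
          · linarith
        simp only [he, h0, h3, not_true_eq_false, false_imp_iff, true_imp_iff, true_and,
          Set.mem_singleton_iff]
        constructor
        · rintro rfl
          norm_num
        · rintro ⟨⟨_, h4⟩, -, h5, -⟩
          linarith
      · refine ⟨1, {1}, by simp, by simp [h0], fun z => ?_⟩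
        have h2 := hxc.2.2 e he
        simp only [Pi.add_apply, h0, h1] at h2
        have h3 : vertexCoord (t e) = 0 := by
          rcases h2 with h2 | h2
          · linarith
          · linarith
        simp only [he, h0, h3, not_true_eq_false, false_imp_iff, true_imp_iff, true_and,
          Set.mem_singleton_iff]
        constructor
        · rintro rfl
          norm_num
        · rintro ⟨⟨h4, _⟩, -, -, h5⟩
          linarith
    · obtain ⟨k, hk⟩ := hint e
      have h2 := hxc.2.1 e he
      have h3 := mem_cube.1 hxc.1 e
      have h4 := mem_cube.1 hx e
      rw [Pi.add_apply] at h2 h3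
      obtain ⟨a, ha⟩ : ∃ a : ℤ, x e = a := by
        rcases vertexCoord_eq (τ e) with h5 | h5
        · exact ⟨-k, by push_cast; linarith⟩
        · exact ⟨1 - k, by push_cast; linarith⟩
      refine ⟨a, {(a : ℝ)}, by simp, by simp [he], fun z => ?_⟩
      simp only [he, not_false_eq_true, false_imp_iff, true_imp_iff, true_and,
        Set.mem_singleton_iff]
      rw [← ha, ← h2]
      constructor
      · rintro rfl
        exact ⟨h3, rfl, h4⟩
      · rintro ⟨-, h5, -⟩
        linarith
  choose a I hoff hon hmem using hI
  refine ⟨a, I, ?_, fun e he => hoff e he, fun e he => hon e he⟩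
  ext z
  simp only [Set.mem_univ_pi, hmem]
  constructor
  · rintro ⟨⟨y, hy, rfl⟩, hz⟩ e
    have h1 : (y - c) e + c e = y e := by simp
    rw [h1]
    exact ⟨mem_cube.1 hy.1 e, hy.2.1 e, hy.2.2 e, mem_cube.1 hz e⟩
  · intro hz
    exact ⟨⟨z + c, ⟨mem_cube.2 fun e => (hz e).1, fun e => (hz e).2.1, fun e => (hz e).2.2.1⟩,
      by simp⟩, mem_cube.2 fun e => (hz e).2.2.2⟩

theorem IsBaseData.mul_pos_of_mem (h : IsBaseData U Us w ws T t τ) {x c : E → ℝ}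
    (hx : x ∈ cube E) (hint : IsIntegralVec c) (hxc : x + c ∈ halfOpenCell T t τ) {e : E}
    (he : e ∈ T) (hce : c e ≠ 0) : 0 < t e * c e := by
  have h2 := hxc.2.2 e he
  rw [Pi.add_apply] at h2
  rcases hint.cases_of_mem_cube hx hxc.1 e with h0 | ⟨h0, h1⟩ | ⟨h0, h1⟩
  · exact absurd h0 hce
  · rw [h0, h1] at h2
    rcases h2 with h2 | h2
    · rw [h0, mul_one]
      exact pos_of_vertexCoord (by linarith)
    · linarith
  · rw [h0, h1] at h2
    rcases h2 with h2 | h2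
    · rw [h0]
      linarith [neg_of_vertexCoord (v := t e) (by linarith) (h.ne_zero_on e he)]
    · linarith

theorem IsBaseData.mul_pos_of_notMem (h : IsBaseData U Us w ws T t τ) {x c : E → ℝ}
    (hx : x ∈ cube E) (hint : IsIntegralVec c) (hxc : x + c ∈ halfOpenCell T t τ) {e : E}
    (he : e ∉ T) (hce : c e ≠ 0) : 0 < τ e * c e := by
  have h2 := hxc.2.1 e he
  rw [Pi.add_apply] at h2
  rcases hint.cases_of_mem_cube hx hxc.1 e with h0 | ⟨h0, h1⟩ | ⟨h0, h1⟩
  · exact absurd h0 hce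
  · rw [h0, h1] at h2
    rw [h0, mul_one]
    exact pos_of_vertexCoord (by linarith)
  · rw [h0, h1] at h2
    rw [h0]
    linarith [neg_of_vertexCoord (v := τ e) (by linarith) (h.ne_zero_off e he)]

variable [Fintype E]

/-- The generating set of a cell determines the base and the translation. -/
theorem IsBaseData.eq_of_generatingSet_eq (h : IsBaseData U Us w ws T t τ)
    (h' : IsBaseData U Us w ws T' t' τ') (hp : IsRegularPair U Us) {x x' c c' : E → ℝ}
    (hx : x ∈ cube E) (hx' : x' ∈ cube E) (hc : c ∈ Us) (hc' : c' ∈ Us)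
    (hint : IsIntegralVec c) (hint' : IsIntegralVec c')
    (hxc : x + c ∈ halfOpenCell T t τ) (hxc' : x' + c' ∈ halfOpenCell T' t' τ')
    (hF : {e | e ∈ T ∧ c e = 0} = {e | e ∈ T' ∧ c' e = 0}) : T = T' ∧ c = c' := by
  have hF' : ∀ e, (e ∈ T ∧ c e = 0) ↔ (e ∈ T' ∧ c' e = 0) := fun e => Set.ext_iff.1 hF e
  have htt : t - t' ∈ U := by simpa using U.sub_mem h.sub_mem_left h'.sub_mem_left
  have hττ : τ - τ' ∈ Us := by simpa using Us.sub_mem h.sub_mem_right h'.sub_mem_right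
  have key : ∀ {S S' : Set E} {a b a' b' z z' d d' : E → ℝ}, IsBaseData U Us w ws S a b →
      IsBaseData U Us w ws S' a' b' → z ∈ cube E → z' ∈ cube E → IsIntegralVec d →
      IsIntegralVec d' → z + d ∈ halfOpenCell S a b → z' + d' ∈ halfOpenCell S' a' b' →
      (∀ e, (e ∈ S ∧ d e = 0) ↔ (e ∈ S' ∧ d' e = 0)) →
      -- If `d e = 0` on `S`, then `e` is in the common generating set and `d' e = 0`. Otherwise `d
      -- e = ±1` with the sign of `a e`, and `d' e` cannot exceed it in that direction.
      ∀ e, 0 ≤ a e * (d e - d' e) ∧ (e ∈ S → a e * (d e - d' e) = 0 → d e = d' e) := by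
    intro S S' a b a' b' z z' d d' hS hS' hz hz' hd hd' hzd hzd' hdF e
    by_cases he : e ∈ S
    · by_cases hde : d e = 0
      · rw [((hdF e).1 ⟨he, hde⟩).2, hde]
        simp
      · have h1 := hS.mul_pos_of_mem hz hd hzd he hde
        have hne := hS.ne_zero_on e he
        refine ⟨?_, fun _ h2 => sub_eq_zero.1 ((mul_eq_zero.1 h2).resolve_left hne)⟩
        rcases hd.cases_of_mem_cube hz hzd.1 e with h2 | ⟨h2, -⟩ | ⟨h2, -⟩ <;>
        rcases hd'.cases_of_mem_cube hz' hzd'.1 e with h3 | ⟨h3, -⟩ | ⟨h3, -⟩ <;>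
        rw [h2] at h1 ⊢ <;> rw [h3] <;> linarith
    · simp [hS.eq_zero_off e he, he]
  have hcc : c = c' := by
    have h0 := hp.dotProduct_eq_zero htt (Us.sub_mem hc hc')
    have h1 := key h h' hx hx' hint hint' hxc hxc' hF'
    have h2 := key h' h hx' hx hint' hint hxc' hxc fun e => (hF' e).symm
    have hzero := (Finset.sum_eq_zero_iff_of_nonneg (fun e _ => by
      have h3 := (h1 e).1
      have h4 := (h2 e).1
      simp only [Pi.sub_apply]
      linarith)).1 h0
    refine sub_eq_zero.1 (h.isBase.2 _ (Us.sub_mem hc hc') fun e he => ?_)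
    have h3 := (h1 e).1
    have h4 := (h2 e).1
    have h5 := hzero e (Finset.mem_univ e)
    simp only [Pi.sub_apply] at h5 ⊢
    rw [(h1 e).2 (not_not.1 he) (by linarith), sub_self]
  subst hcc
  refine ⟨?_, rfl⟩
  -- At an edge of exactly one base `c` is nonzero, and its sign is that of `t` for one base and of
  -- `τ` for the other, so the term is negative.
  have h0 := hp.dotProduct_eq_zero htt hττ
  have hsign : ∀ {a b d : ℝ}, 0 < a * d → 0 < b * d → 0 < a * b := by
    intro a b d h1 h2
    rcases lt_trichotomy d 0 with h3 | h3 | h3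
    · exact mul_pos_of_neg_of_neg (by nlinarith) (by nlinarith)
    · simp [h3] at h1
    · exact mul_pos (by nlinarith) (by nlinarith)
  have hneg : ∀ e, (t - t') e * (τ - τ') e ≤ 0 ∧
      ((e ∈ T ∧ e ∉ T') ∨ (e ∈ T' ∧ e ∉ T) → (t - t') e * (τ - τ') e < 0) := by
    intro e
    by_cases h1 : e ∈ T <;> by_cases h2 : e ∈ T'
    · simp [h1, h2, h.eq_zero_on e h1, h'.eq_zero_on e h2]
    · have hce : c e ≠ 0 := fun h3 => h2 ((hF' e).1 ⟨h1, h3⟩).1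
      have := hsign (h.mul_pos_of_mem hx hint hxc h1 hce)
        (h'.mul_pos_of_notMem hx' hint' hxc' h2 hce)
      simp only [Pi.sub_apply, h.eq_zero_on e h1, h'.eq_zero_off e h2]
      exact ⟨by linarith, fun _ => by linarith⟩
    · have hce : c e ≠ 0 := fun h3 => h1 ((hF' e).2 ⟨h2, h3⟩).1
      have := hsign (h'.mul_pos_of_mem hx' hint' hxc' h2 hce)
        (h.mul_pos_of_notMem hx hint hxc h1 hce)
      simp only [Pi.sub_apply, h'.eq_zero_on e h2, h.eq_zero_off e h1]
      exact ⟨by linarith, fun _ => by linarith⟩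
    · simp [h1, h2, h.eq_zero_off e h1, h'.eq_zero_off e h2]
  have hzero := (Finset.sum_eq_zero_iff_of_nonpos (fun e _ => (hneg e).1)).1 h0
  ext e
  by_contra hne
  exact ((hneg e).2 (by tauto)).ne (hzero e (Finset.mem_univ e))

/-- Every independent set is the generating set of the cell of some orientation. -/
theorem IsRegularPair.exists_generatingSet_eq (hp : IsRegularPair U Us) (hw : IsGeneric U w)
    (hws : IsGeneric Us ws) {F : Set E} (hF : IsIndep U F) :
    ∃ T t τ, IsBaseData U Us w ws T t τ ∧ ∃ c ∈ Us, IsIntegralVec c ∧ ∃ x, IsOrientation x ∧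
      x + c ∈ halfOpenCell T t τ ∧ {e | e ∈ T ∧ c e = 0} = F := by
  classical
  -- The translation is the best `{0, ±1}`-tension vanishing on `F`. Its signs define the orthant:
  -- free on `F`, the sign of `c` elsewhere, and `0` where `c` vanishes off `F`.
  obtain ⟨c, hc, ⟨hcF, hval⟩, hmax⟩ := exists_maximal_dotProduct Us ws
    (fun c => (∀ e ∈ F, c e = 0) ∧ ∀ e, c e = 0 ∨ c e = 1 ∨ c e = -1)
    ⟨by simp, by simp⟩ (fun c hc => hc.2)
  obtain ⟨T, t, τ, hdata, hto, hfree, hoff⟩ := hp.exists_isBaseData_inOrthant hw hws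
    (pos := fun e => e ∈ F ∨ 0 < c e) (neg := fun e => e ∈ F ∨ c e < 0)
    -- Boundedness: a descent ray `-d` pairs with `c` strictly at every edge of `d` off `F`. By
    -- orthogonality `d` would be supported in the independent set `F`.
    (fun d hd _ horth => by
      have hle : ∀ e, d e * c e ≤ 0 ∧ (d e ≠ 0 → e ∉ F → d e * c e < 0) := by
        intro e
        by_cases heF : e ∈ F
        · simp [hcF e heF, heF]
        rcases hd.values e with h | h | h
        · simp [h]
        · have h1 := ((horth e).2 (by simp [h])).resolve_left heF
          rw [h]
          exact ⟨by linarith, fun _ _ => by linarith⟩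
        · have h1 := ((horth e).1 (by simp [h])).resolve_left heF
          rw [h]
          exact ⟨by linarith, fun _ _ => by linarith⟩
      have hzero := (Finset.sum_eq_zero_iff_of_nonpos (fun e _ => (hle e).1)).1
        (hp.dotProduct_eq_zero hd.mem hc)
      refine hd.ne_zero (hF d hd.mem fun e he => ?_)
      by_contra hde
      exact ((hle e).2 hde he).ne (hzero e (Finset.mem_univ e)))
    -- Feasibility: an obstructing circuit `d` vanishes on `F` and `c - d` still has entries `0,
    -- ±1`, so maximality of `c` makes `ws` positive on `d`.
    (fun d hd hde => by
      by_contra hneg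
      have hlt := lt_of_le_of_ne (not_lt.1 hneg) (hws d hd)
      have := hmax (c - d) (Us.sub_mem hc hd.mem) ⟨fun e he => by
          rw [Pi.sub_apply, hcF e he, zero_sub, neg_eq_zero]
          rcases hd.values e with h | h | h
          · exact h
          · exact absurd (Or.inl he) ((hde e).1 (by rw [h]; norm_num))
          · exact absurd (Or.inl he) ((hde e).2 (by rw [h]; norm_num)), fun e => by
          rw [Pi.sub_apply]
          rcases hd.values e with h | h | h
          · simpa [h] using hval e
          · have h1 := (hde e).1 (by rw [h]; norm_num)
            push Not at h1
            rcases hval e with h2 | h2 | h2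
            · simp [h, h2]
            · simp [h, h2]
            · linarith [h1.2]
          · have h1 := (hde e).2 (by rw [h]; norm_num)
            push Not at h1
            rcases hval e with h2 | h2 | h2
            · simp [h, h2]
            · linarith [h1.2]
            · simp [h, h2]⟩
      rw [dotProduct_sub] at this
      linarith)
  -- The vertex contained in the cell of `T`. The signs of `t` and `τ` agree with `c` wherever `c`
  -- is nonzero, so `y - c` is again an orientation.
  let y : E → ℝ := fun e => if e ∈ T then vertexCoord (t e) else vertexCoord (τ e)
  have hyor : IsOrientation y := fun e => by
    simp only [y]
    split_ifs <;> exact vertexCoord_eq _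
  have hy : y ∈ halfOpenCell T t τ := ⟨hyor.mem_cube, fun e he => by simp [y, he],
    fun e he => Or.inl (by simp [y, he])⟩
  have hgen : ∀ e, e ∈ T → c e = 0 → e ∈ F := by
    intro e he hce
    by_contra heF
    rcases (hdata.ne_zero_on e he).lt_or_gt with h | h
    · have := ((hto e).2 h).resolve_left heF
      linarith
    · have := ((hto e).1 h).resolve_left heF
      linarith
  have hsign : ∀ e, (c e = 1 → y e = 1) ∧ (c e = -1 → y e = 0) := by
    intro e
    by_cases he : e ∈ T
    · simp only [y, he, if_true]
      rcases (hdata.ne_zero_on e he).lt_or_gt with h | h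
      · refine ⟨fun h1 => ?_, fun _ => vertexCoord_of_neg h⟩
        rcases (hto e).2 h with h2 | h2
        · rw [hcF e h2] at h1
          norm_num at h1
        · linarith
      · refine ⟨fun _ => vertexCoord_of_pos h, fun h1 => ?_⟩
        rcases (hto e).1 h with h2 | h2
        · rw [hcF e h2] at h1
          norm_num at h1
        · linarith
    · simp only [y, he, if_false]
      have h2 := hoff e he
      push Not at h2
      rcases (hdata.ne_zero_off e he).lt_or_gt with h | h
      · refine ⟨fun h1 => ?_, fun _ => vertexCoord_of_neg h⟩
        linarith [(h2.2 h).2]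
      · refine ⟨fun _ => vertexCoord_of_pos h, fun h1 => ?_⟩
        linarith [(h2.1 h).2]
  refine ⟨T, t, τ, hdata, c, hc, isIntegralVec_of_values hval, y - c, fun e => ?_, by simpa using hy,
    ?_⟩
  · rw [Pi.sub_apply]
    rcases hval e with h | h | h
    · simpa [h] using hyor e
    · rw [(hsign e).1 h, h]
      norm_num
    · rw [(hsign e).2 h, h]
      norm_num
  · ext e
    exact ⟨fun h => hgen e h.1 h.2, fun h => ⟨hfree e (Or.inl h) (Or.inl h), hcF e h⟩⟩

end StandardCells

/-! ### Flows and tensions of a graph form a regular pair -/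

section GraphSpaces

/-- A signed circuit conforming to a signed circuit equals it, so a family of signed circuits to
which every nonzero vector conforms is already the whole family. -/
theorem isSignedCircuit_iff_of_conformal {E : Type*} {U : Submodule ℝ (E → ℝ)}
    {P : (E → ℝ) → Prop} (hP : ∀ c, P c → IsSignedCircuit U c)
    (hex : ∀ u ∈ U, u ≠ 0 → ∃ c, P c ∧ ConformsTo c u) (c : E → ℝ) :
    P c ↔ IsSignedCircuit U c := by
  refine ⟨hP c, fun hc => ?_⟩
  obtain ⟨d, hd, hdc⟩ := hex c hc.mem hc.ne_zero
  rwa [← hdc.eq_of_isSignedCircuit hc (hP d hd)]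

variable {V E : Type*} (G : OrientedGraph V E)

/-- The differences of a potential along the edges. -/
def coboundary : (V → ℝ) →ₗ[ℝ] (E → ℝ) :=
  LinearMap.funLeft ℝ ℝ G.head - LinearMap.funLeft ℝ ℝ G.tail

theorem coboundary_apply (h : V → ℝ) (e : E) :
    G.coboundary h e = h (G.head e) - h (G.tail e) := rfl

/-- The cocycle space. -/
def tensions : Submodule ℝ (E → ℝ) := LinearMap.range G.coboundary

theorem cutVec_cases (W : Set V) (e : E) :
    (G.cutVec W e = 0 ∧ (G.tail e ∈ W ↔ G.head e ∈ W)) ∨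
    (G.cutVec W e = 1 ∧ G.tail e ∈ W ∧ G.head e ∉ W) ∨
    (G.cutVec W e = -1 ∧ G.head e ∈ W ∧ G.tail e ∉ W) := by
  unfold cutVec
  by_cases h1 : G.tail e ∈ W <;> by_cases h2 : G.head e ∈ W <;> simp [h1, h2]

theorem cutVec_values (W : Set V) (e : E) :
    G.cutVec W e = 0 ∨ G.cutVec W e = 1 ∨ G.cutVec W e = -1 := by
  rcases G.cutVec_cases W e with h | h | h <;> simp [h.1]

theorem mem_cut_iff (W : Set V) (e : E) : e ∈ G.cut W ↔ G.cutVec W e ≠ 0 := by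
  rcases G.cutVec_cases W e with h | h | h
  · simp only [h.1, cut, ne_eq, not_true_eq_false, iff_false]
    change ¬ ((_ ∧ _) ∨ (_ ∧ _))
    tauto
  · simp only [h.1, ne_eq, one_ne_zero, not_false_eq_true, iff_true]
    exact Or.inl h.2
  · simp only [h.1, ne_eq, neg_eq_zero, one_ne_zero, not_false_eq_true, iff_true]
    exact Or.inr h.2

theorem support_cutVec (W : Set V) : Function.support (G.cutVec W) = G.cut W :=
  Set.ext fun e => (G.mem_cut_iff W e).symm

theorem cutVec_compl (W : Set V) : G.cutVec Wᶜ = -G.cutVec W := by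
  ext e
  unfold cutVec
  by_cases h1 : G.tail e ∈ W <;> by_cases h2 : G.head e ∈ W <;> simp [h1, h2]

theorem cutVec_mem_tensions (W : Set V) : G.cutVec W ∈ G.tensions := by
  classical
  refine ⟨fun v => if v ∈ W then -1 else 0, ?_⟩
  ext e
  rw [coboundary_apply]
  unfold cutVec
  by_cases h1 : G.tail e ∈ W <;> by_cases h2 : G.head e ∈ W <;> simp [h1, h2]

theorem exists_cutVec_conformsTo {s : E → ℝ} (hs : s ∈ G.tensions) (hs0 : s ≠ 0) :
    ∃ W, (G.cut W).Nonempty ∧ ConformsTo (G.cutVec W) s := by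
  obtain ⟨h, rfl⟩ := hs
  obtain ⟨e₀, he₀⟩ := Function.ne_iff.1 hs0
  rw [coboundary_apply, Pi.zero_apply] at he₀
  -- The potential increases along every edge leaving a sublevel set, and this level separates the
  -- ends of `e₀`.
  refine ⟨{v | h v ≤ min (h (G.head e₀)) (h (G.tail e₀))}, ⟨e₀, ?_⟩, fun e he => ?_⟩
  · rcases lt_or_gt_of_ne (sub_ne_zero.1 he₀) with h1 | h1
    · exact Or.inr ⟨by simp [h1.le], by simp [h1]⟩
    · exact Or.inl ⟨by simp [h1.le], by simp [h1]⟩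
  · rw [coboundary_apply]
    rcases G.cutVec_cases {v | h v ≤ min (h (G.head e₀)) (h (G.tail e₀))} e with h1 | h1 | h1
    · exact absurd h1.1 he
    · obtain ⟨h2, h3, h4⟩ := h1
      have h5 : h (G.tail e) < h (G.head e) := lt_of_le_of_lt h3 (not_le.1 h4)
      rw [h2]
      linarith
    · obtain ⟨h2, h3, h4⟩ := h1
      have h5 : h (G.head e) < h (G.tail e) := lt_of_le_of_lt h3 (not_le.1 h4)
      rw [h2]
      linarith

theorem IsDirectedCocycle.isSignedCircuit {G : OrientedGraph V E} {c : E → ℝ}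
    (hc : G.IsDirectedCocycle c) : IsSignedCircuit G.tensions c := by
  obtain ⟨W, hW, rfl⟩ := hc
  obtain ⟨e₀, he₀⟩ := hW.prop.1
  refine ⟨G.cutVec_mem_tensions W, fun h0 => ?_, G.cutVec_values W, fun s hs hsW => ?_⟩
  · rw [mem_cut_iff, h0] at he₀
    exact he₀ rfl
  -- The multiple that cancels `s` at `e₀`. A nonzero difference would yield a nonempty cut inside
  -- that of `W` missing `e₀`, against minimality.
  · refine ⟨s e₀ * G.cutVec W e₀, ?_⟩
    by_contra hne
    obtain ⟨W', hW', hconf⟩ := G.exists_cutVec_conformsTo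
      (G.tensions.sub_mem hs (G.tensions.smul_mem (s e₀ * G.cutVec W e₀)
        (G.cutVec_mem_tensions W))) (sub_ne_zero.2 hne)
    have hsub : G.cut W' ≤ G.cut W := by
      intro e he
      rw [mem_cut_iff] at he ⊢
      intro h0
      apply hconf.ne_zero he
      simp [h0, hsW e h0]
    have h1 := hW.le_of_le ⟨hW', W', rfl⟩ hsub he₀
    rw [mem_cut_iff] at h1 he₀
    apply hconf.ne_zero h1
    simp only [Pi.sub_apply, Pi.smul_apply, smul_eq_mul]
    rcases G.cutVec_values W e₀ with h | h | h
    · exact absurd h he₀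
    · rw [h]; ring
    · rw [h]; ring

/-- A conforming cut with the fewest edges is a cocycle. If it properly contained a cut, subtracting
that cut, signed so as to cancel at `e₀`, would leave a tension to which a smaller cut conforms, and
this cut also conforms to `s`. -/
theorem exists_isDirectedCocycle_conformsTo [Finite E] {s : E → ℝ} (hs : s ∈ G.tensions)
    (hs0 : s ≠ 0) : ∃ c, G.IsDirectedCocycle c ∧ ConformsTo c s := by
  have hex : ∃ n W, (G.cut W).Nonempty ∧ ConformsTo (G.cutVec W) s ∧ (G.cut W).ncard = n := by
    obtain ⟨W, h1, h2⟩ := G.exists_cutVec_conformsTo hs hs0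
    exact ⟨_, W, h1, h2, rfl⟩
  classical
  obtain ⟨W, hne, hconf, hcard⟩ := Nat.find_spec hex
  have hmin := fun m => Nat.find_min hex (m := m)
  rw [← hcard] at hmin
  refine ⟨G.cutVec W, ⟨W, ⟨⟨hne, W, rfl⟩, ?_⟩, rfl⟩, hconf⟩
  rintro S ⟨⟨e₀, he₀⟩, W₁, rfl⟩ hle e₁ he₁
  by_contra he₁'
  obtain ⟨W', hcut, hW'⟩ : ∃ W', (∀ e, G.cutVec W' e = 0 ↔ G.cutVec W₁ e = 0) ∧
      G.cutVec W' e₀ = G.cutVec W e₀ := by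
    have h1 := (G.mem_cut_iff W₁ e₀).1 he₀
    have h2 := (G.mem_cut_iff W e₀).1 (hle he₀)
    by_cases heq : G.cutVec W₁ e₀ = G.cutVec W e₀
    · exact ⟨W₁, fun _ => Iff.rfl, heq⟩
    · refine ⟨W₁ᶜ, fun e => by simp [cutVec_compl], ?_⟩
      rw [cutVec_compl, Pi.neg_apply]
      rcases G.cutVec_values W₁ e₀ with h3 | h3 | h3 <;>
        rcases G.cutVec_values W e₀ with h4 | h4 | h4 <;> simp_all
  have hd0 : G.cutVec W - G.cutVec W' ≠ 0 := by
    intro h0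
    rw [mem_cut_iff] at he₁ he₁'
    have := congrFun h0 e₁
    rw [Pi.sub_apply, (hcut e₁).2 (not_not.1 he₁'), sub_zero] at this
    exact he₁ this
  obtain ⟨W₂, hne₂, hconf₂⟩ := G.exists_cutVec_conformsTo
    (G.tensions.sub_mem (G.cutVec_mem_tensions W) (G.cutVec_mem_tensions W')) hd0
  have hW₂ : ∀ e, G.cutVec W₂ e ≠ 0 → G.cutVec W₂ e = G.cutVec W e := by
    intro e he
    have h1 := hconf₂ e he
    rw [Pi.sub_apply] at h1
    have h0 : G.cutVec W e = 0 → G.cutVec W' e = 0 := by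
      intro h2
      rw [hcut]
      by_contra h3
      exact (G.mem_cut_iff W e).1 (hle ((G.mem_cut_iff W₁ e).2 h3)) h2
    rcases G.cutVec_values W₂ e with h3 | h3 | h3 <;>
      rcases G.cutVec_values W e with h4 | h4 | h4 <;>
      rcases G.cutVec_values W' e with h5 | h5 | h5 <;>
      simp [h3, h4, h5] at h0 h1 he ⊢ <;> norm_num at h1
  refine hmin (G.cut W₂).ncard (Set.ncard_lt_ncard ⟨fun e he => ?_, fun h => ?_⟩
    (Set.toFinite _)) ⟨W₂, hne₂, fun e he => ?_, rfl⟩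
  · rw [mem_cut_iff] at he ⊢
    rwa [← hW₂ e he]
  · have := (G.mem_cut_iff W₂ e₀).1 (h (hle he₀))
    apply hconf₂.ne_zero this
    simp [hW']
  · rw [hW₂ e he]
    exact hconf e (by rwa [← hW₂ e he])

theorem isDirectedCocycle_iff [Finite E] (c : E → ℝ) :
    G.IsDirectedCocycle c ↔ IsSignedCircuit G.tensions c :=
  isSignedCircuit_iff_of_conformal (fun _ h => h.isSignedCircuit)
    (fun _ hs hs0 => G.exists_isDirectedCocycle_conformsTo hs hs0) c

variable [Fintype E]

/-- The cycle space. -/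
def flows : Submodule ℝ (E → ℝ) where
  carrier := {u | ∀ h : V → ℝ, u ⬝ᵥ G.coboundary h = 0}
  add_mem' hu hv h := by rw [add_dotProduct, hu h, hv h, add_zero]
  zero_mem' h := zero_dotProduct _
  smul_mem' a u hu h := by rw [smul_dotProduct, hu h, smul_zero]

theorem IsDirectedCycle.isSignedCircuit {G : OrientedGraph V E} {c : E → ℝ}
    (hc : G.IsDirectedCycle c) : IsSignedCircuit G.flows c := by
  classical
  obtain ⟨n, v, e, hv, he, hdir, hoff⟩ := hc
  have hval : ∀ i, c (e i) = 1 ∨ c (e i) = -1 := fun i => by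
    rcases hdir i with h | h
    · exact Or.inl h.2.2
    · exact Or.inr h.2.2
  have hsum : ∀ (u : E → ℝ), (∀ f, f ∉ Set.range e → u f = 0) → ∀ h : V → ℝ,
      u ⬝ᵥ G.coboundary h = ∑ i, u (e i) * c (e i) * (h (v (i + 1)) - h (v i)) := by
    intro u hu h
    refine (Fintype.sum_of_injective e he _ _ (fun f hf => by simp [hu f hf]) fun i => ?_).symm
    rw [coboundary_apply]
    rcases hdir i with ⟨h1, h2, h3⟩ | ⟨h1, h2, h3⟩ <;> rw [h1, h2, h3] <;> ring
  refine ⟨fun h => ?_, fun h0 => ?_, fun f => ?_, fun u hu huc => ?_⟩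
  · rw [hsum c hoff]
    have h1 : ∀ i, c (e i) * c (e i) * (h (v (i + 1)) - h (v i)) = h (v (i + 1)) - h (v i) := by
      intro i
      rcases hval i with h2 | h2 <;> rw [h2] <;> ring
    simp only [h1, Finset.sum_sub_distrib]
    rw [sub_eq_zero]
    exact Equiv.sum_comp (Equiv.addRight (1 : Fin (n + 1))) (fun i => h (v i))
  · rcases hval 0 with h | h <;> simp [h0] at h
  · by_cases hf : f ∈ Set.range e
    · obtain ⟨i, rfl⟩ := hf
      exact Or.inr (hval i)
    · exact Or.inl (hoff f hf)
  · have hconst : ∀ j, u (e j) * c (e j) = u (e (j + 1)) * c (e (j + 1)) := by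
      intro j
      -- Flow conservation at the vertex between two consecutive edges of the cycle.
      have h1 := hu (fun x => if x = v (j + 1) then 1 else 0)
      rw [hsum u (fun f hf => huc f (hoff f hf))] at h1
      simp only [hv.eq_iff, add_left_inj, mul_sub, mul_ite, mul_one, mul_zero,
        Finset.sum_sub_distrib, Finset.sum_ite_eq', Finset.mem_univ, if_true] at h1
      linarith
    have hall : ∀ j, u (e j) * c (e j) = u (e 0) * c (e 0) := by
      intro j
      induction j using Fin.induction with
      | zero => rfl
      | succ j ih => rw [← ih, hconst j.castSucc, Fin.coeSucc_eq_succ]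
    refine ⟨u (e 0) * c (e 0), ?_⟩
    ext f
    rw [Pi.smul_apply, smul_eq_mul]
    by_cases hf : f ∈ Set.range e
    · obtain ⟨i, rfl⟩ := hf
      rw [← hall i]
      rcases hval i with h | h <;> rw [h] <;> ring
    · rw [hoff f hf, huc f (hoff f hf), mul_zero]

/-- With edges redirected along `u`, the flow is positive, so by conservation a vertex that is
entered can be left. Fixing one outgoing edge per vertex gives a self-map of a finite set, and a
periodic orbit of minimal period is a simple directed cycle. -/
theorem exists_isDirectedCycle_conformsTo [Finite V] {u : E → ℝ} (hu : u ∈ G.flows)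
    (hu0 : u ≠ 0) : ∃ c, G.IsDirectedCycle c ∧ ConformsTo c u := by
  classical
  let src : E → V := fun e => if 0 < u e then G.tail e else G.head e
  let dst : E → V := fun e => if 0 < u e then G.head e else G.tail e
  have hbal : ∀ h : V → ℝ, ∑ e, |u e| * (h (dst e) - h (src e)) = 0 := by
    intro h
    rw [← hu h]
    refine Finset.sum_congr rfl fun e _ => ?_
    rw [coboundary_apply]
    by_cases he : 0 < u e
    · simp [src, dst, he, abs_of_pos he]
    · simp only [src, dst, he, if_false, abs_of_nonpos (not_lt.1 he)]
      ring
  let A : Set V := {x | ∃ e, u e ≠ 0 ∧ src e = x}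
  have hdst : ∀ e, u e ≠ 0 → dst e ∈ A := by
    intro e he
    by_contra hA
    have h1 := hbal (fun x => if x = dst e then 1 else 0)
    have hterm : ∀ f, |u f| * ((if dst f = dst e then (1 : ℝ) else 0) -
        (if src f = dst e then 1 else 0)) = if dst f = dst e then |u f| else 0 := by
      intro f
      by_cases hf : u f = 0
      · simp [hf]
      · have : src f ≠ dst e := fun h => hA ⟨f, hf, h⟩
        simp [this]
    simp only [hterm] at h1
    have h2 := (Finset.sum_eq_zero_iff_of_nonneg (fun f _ => by
      split_ifs <;> simp)).1 h1 e (Finset.mem_univ e)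
    simp at h2
    exact he h2
  choose pick hpick hsrc using fun x : A => x.2
  let f : A → A := fun x => ⟨dst (pick x), hdst _ (hpick x)⟩
  obtain ⟨e₀, he₀⟩ := Function.ne_iff.1 hu0
  obtain ⟨i, j, hij, heq⟩ : ∃ i j : ℕ, i < j ∧
      f^[i] ⟨src e₀, e₀, he₀, rfl⟩ = f^[j] ⟨src e₀, e₀, he₀, rfl⟩ := by
    obtain ⟨i, j, hne, h⟩ := Finite.exists_ne_map_eq_of_infinite
      fun i : ℕ => f^[i] (⟨src e₀, e₀, he₀, rfl⟩ : A)
    rcases hne.lt_or_gt with h1 | h1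
    · exact ⟨i, j, h1, h⟩
    · exact ⟨j, i, h1, h.symm⟩
  set p : A := f^[i] ⟨src e₀, e₀, he₀, rfl⟩ with hp
  have hper : Function.IsPeriodicPt f (j - i) p := by
    change f^[j - i] p = p
    conv_rhs => rw [heq]
    rw [hp, ← Function.iterate_add_apply]
    congr 2
    omega
  obtain ⟨n, hn⟩ : ∃ n, Function.minimalPeriod f p = n + 1 :=
    Nat.exists_eq_succ_of_ne_zero (hper.minimalPeriod_pos (by omega)).ne'
  have hinj : Function.Injective fun k : Fin (n + 1) => f^[k] p := by
    intro k l hkl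
    exact Fin.ext (Function.iterate_injOn_Iio_minimalPeriod (f := f) (x := p)
      (by rw [hn]; exact k.2) (by rw [hn]; exact l.2) hkl)
  have hstep : ∀ k : Fin (n + 1), f^[(k + 1 : Fin (n + 1))] p = f (f^[k] p) := by
    intro k
    rw [← Function.iterate_succ_apply' f]
    by_cases hk : k = Fin.last n
    · subst hk
      simp only [Fin.last_add_one, Fin.val_zero, Function.iterate_zero, id_eq, Fin.val_last]
      have := Function.iterate_minimalPeriod (f := f) (x := p)
      rw [hn] at this
      exact this.symm
    · rw [Fin.val_add_one_of_lt (Fin.lt_last_iff_ne_last.2 hk)]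
  let e : Fin (n + 1) → E := fun k => pick (f^[k] p)
  have he : Function.Injective e := by
    intro k l hkl
    apply hinj
    apply Subtype.ext
    change ((f^[k] p : A) : V) = (f^[l] p : A)
    rw [← hsrc, ← hsrc]
    exact congrArg src hkl
  refine ⟨fun a => if a ∈ Set.range e then (if 0 < u a then 1 else -1) else 0,
    ⟨n, fun k => (f^[k] p : A), e, fun k l hkl => hinj (Subtype.ext hkl), he, fun k => ?_,
      fun a ha => by simp only [ha, if_false]⟩, fun a ha => ?_⟩
  · have h1 : src (e k) = (f^[k] p : A) := hsrc _
    have h2 : dst (e k) = (f^[(k + 1 : Fin (n + 1))] p : A) := by rw [hstep]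
    have h3 : e k ∈ Set.range e := ⟨k, rfl⟩
    simp only [h3, if_true]
    by_cases h4 : 0 < u (e k)
    · left
      simp only [src, dst, h4, if_true] at h1 h2 ⊢
      exact ⟨h1, h2, trivial⟩
    · right
      simp only [src, dst, h4, if_false] at h1 h2 ⊢
      exact ⟨h1, h2, trivial⟩
  · by_cases h1 : a ∈ Set.range e
    · obtain ⟨k, rfl⟩ := h1
      have h3 : e k ∈ Set.range e := ⟨k, rfl⟩
      simp only [h3, if_true]
      have h2 : u (e k) ≠ 0 := hpick _
      by_cases h4 : 0 < u (e k)
      · simp [h4]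
      · have := lt_of_le_of_ne (not_lt.1 h4) h2
        simpa [h4] using this
    · simp [h1] at ha

theorem isDirectedCycle_iff [Finite V] (c : E → ℝ) :
    G.IsDirectedCycle c ↔ IsSignedCircuit G.flows c :=
  isSignedCircuit_iff_of_conformal (fun _ h => h.isSignedCircuit)
    (fun _ hu hu0 => G.exists_isDirectedCycle_conformsTo hu hu0) c

theorem isRegularPair [Finite V] : IsRegularPair G.flows G.tensions where
  mem_left_iff u := by
    refine ⟨?_, fun h v => h _ ⟨v, rfl⟩⟩
    rintro h _ ⟨v, rfl⟩
    exact h v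
  mem_right_iff s := by
    constructor
    · rintro ⟨v, rfl⟩ u hu
      rw [dotProduct_comm]
      exact hu v
    · intro h
      by_contra hs
      obtain ⟨u, hus, hu⟩ := exists_dotProduct_ne_zero hs
      apply hus
      rw [dotProduct_comm]
      exact h u fun v => hu _ ⟨v, rfl⟩
  left u hu hu0 := by
    obtain ⟨c, hc, hcu⟩ := G.exists_isDirectedCycle_conformsTo hu hu0
    exact ⟨c, hc.isSignedCircuit, hcu⟩
  right s hs hs0 := by
    obtain ⟨c, hc, hcs⟩ := G.exists_isDirectedCocycle_conformsTo hs hs0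
    exact ⟨c, hc.isSignedCircuit, hcs⟩

theorem isForest_iff [Finite V] (F : Set E) : G.IsForest F ↔ IsIndep G.flows F := by
  constructor
  · intro h u hu huF
    by_contra hu0
    obtain ⟨c, hc, hcu⟩ := G.exists_isDirectedCycle_conformsTo hu hu0
    refine h _ ⟨c, hc, rfl⟩ fun e he => ?_
    by_contra heF
    exact hcu.ne_zero he (huF e heF)
  · rintro h _ ⟨c, hc, rfl⟩ hcF
    refine hc.isSignedCircuit.ne_zero (h c hc.isSignedCircuit.mem fun e he => ?_)
    by_contra hne
    exact he (hcF hne)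

omit [Fintype E] in
-- A tension vanishing on a connected `T` has constant potential. Conversely, the cut of the set
-- reachable within `T` avoids `T`, so it is empty, and connectedness of the graph makes everything
-- reachable.
theorem isConnectedOn_iff (hG : G.IsConnected) (T : Set E) :
    G.IsConnectedOn T ↔ IsIndep G.tensions Tᶜ := by
  constructor
  · rintro ⟨-, h⟩ _ ⟨p, rfl⟩ hp
    have hconst : ∀ u v, p u = p v := by
      intro u v
      induction h u v with
      | refl => rfl
      | tail _ hstep ih =>
        obtain ⟨e, he, h1⟩ := hstep
        have h2 := hp e (fun h => h he)
        rw [coboundary_apply] at h2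
        rcases h1 with ⟨rfl, rfl⟩ | ⟨rfl, rfl⟩ <;> linarith
    ext e
    rw [coboundary_apply, hconst (G.head e) (G.tail e), sub_self, Pi.zero_apply]
  · intro h
    refine ⟨hG.1, fun u v => ?_⟩
    set R := fun a b => ∃ e ∈ T, (G.tail e = a ∧ G.head e = b) ∨ (G.head e = a ∧ G.tail e = b)
    have hcut : G.cutVec {x | Relation.ReflTransGen R u x} = 0 := by
      refine h _ (G.cutVec_mem_tensions _) fun e he => ?_
      have heT : e ∈ T := not_not.1 he
      rcases G.cutVec_cases {x | Relation.ReflTransGen R u x} e with h1 | ⟨-, h2, h3⟩ | ⟨-, h2, h3⟩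
      · exact h1.1
      · exact absurd (Relation.ReflTransGen.tail h2 ⟨e, heT, Or.inl ⟨rfl, rfl⟩⟩) h3
      · exact absurd (Relation.ReflTransGen.tail h2 ⟨e, heT, Or.inr ⟨rfl, rfl⟩⟩) h3
    have hiff : ∀ e, Relation.ReflTransGen R u (G.tail e) ↔
        Relation.ReflTransGen R u (G.head e) := by
      intro e
      rcases G.cutVec_cases {x | Relation.ReflTransGen R u x} e with h1 | ⟨h1, -⟩ | ⟨h1, -⟩
      · exact h1.2
      · rw [hcut] at h1
        norm_num at h1
      · rw [hcut] at h1
        norm_num at h1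
    induction hG.2 u v with
    | refl => exact Relation.ReflTransGen.refl
    | tail _ hstep ih =>
      obtain ⟨e, -, ⟨rfl, rfl⟩ | ⟨rfl, rfl⟩⟩ := hstep
      · exact (hiff e).1 ih
      · exact (hiff e).2 ih

theorem isSpanningTree_iff [Finite V] (hG : G.IsConnected) (T : Set E) :
    G.IsSpanningTree T ↔ IsBase G.flows G.tensions T :=
  and_congr (G.isForest_iff T) (G.isConnectedOn_iff hG T)

omit [Fintype E] in
-- Constants have zero coboundary, so a potential can be normalised to vanish at `q`; deleting the
-- row of `q` loses nothing.
theorem incMatrix_transpose_mulVec [Fintype V] (q : V) [DecidableEq V] (p : V → ℝ) :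
    ((G.incMatrix q).transpose.mulVec fun v => p v.1 - p q) = G.coboundary p := by
  ext e
  rw [coboundary_apply]
  have hsingle : ∀ x : V, ∑ v : {v : V // v ≠ q}, (if x = v.1 then p v.1 - p q else 0) =
      p x - p q := by
    intro x
    by_cases hx : x = q
    · subst hx
      rw [sub_self]
      exact Finset.sum_eq_zero fun v _ => if_neg v.2.symm
    · rw [Finset.sum_eq_single (⟨x, hx⟩ : {v : V // v ≠ q})]
      · simp
      · intro v _ hv
        exact if_neg fun h => hv (Subtype.ext h.symm)
      · simp
  have hterm : ∀ v : {v : V // v ≠ q}, (G.incMatrix q).transpose e v * (p v.1 - p q) =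
      (if G.head e = v.1 then p v.1 - p q else 0) -
        (if G.tail e = v.1 then p v.1 - p q else 0) := by
    intro v
    simp only [incMatrix, Matrix.transpose_apply, Matrix.of_apply]
    by_cases h1 : G.tail e = G.head e
    · simp [h1]
    · by_cases h2 : G.head e = v.1
      · have h3 : G.tail e ≠ v.1 := fun h => h1 (h.trans h2.symm)
        simp [h2, h3]
      · by_cases h3 : G.tail e = v.1
        · have h4 : v.1 ≠ G.head e := fun h => h2 h.symm
          simp [h3, h2, h4]
        · simp [h2, h3]
  calc _ = ∑ v : {v : V // v ≠ q}, (G.incMatrix q).transpose e v * (p v.1 - p q) := rfl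
    _ = (p (G.head e) - p q) - (p (G.tail e) - p q) := by
      simp only [hterm, Finset.sum_sub_distrib]
      rw [← hsingle (G.head e), ← hsingle (G.tail e)]
    _ = _ := by ring

omit [Fintype E] in
theorem mem_intCocycleSpace_iff [Fintype V] (q : V) (c : E → ℝ) :
    c ∈ G.intCocycleSpace q ↔ c ∈ G.tensions ∧ IsIntegralVec c := by
  classical
  refine and_congr ⟨?_, ?_⟩ Iff.rfl
  · rintro ⟨y, hy⟩
    refine ⟨fun v => if h : v = q then 0 else y ⟨v, h⟩, ?_⟩
    rw [← hy, ← G.incMatrix_transpose_mulVec q]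
    congr 1
    ext v
    simp [v.2]
  · rintro ⟨p, rfl⟩
    exact ⟨_, G.incMatrix_transpose_mulVec q p⟩

end GraphSpaces

/-! ### Signatures represented by functionals -/

section Signatures

variable {E : Type*} [Fintype E] {IsC : Set E → Prop} {IsD : (E → ℝ) → Prop}

theorem _root_.Signature.IsAcyclic.exists_dotProduct_pos {σ : Signature IsC IsD}
    (hσ : σ.IsAcyclic) : ∃ w : E → ℝ, ∀ C, IsC C → 0 < w ⬝ᵥ σ.dir C := by
  classical
  obtain ⟨w, hw⟩ := exists_forall_dotProduct_pos (fun C : {C : Set E // IsC C} => σ.dir C.1)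
    (fun a ha h0 => hσ a ha (by convert h0))
  exact ⟨w, fun C hC => hw ⟨C, hC⟩⟩

/-- The signature consists of the signed circuits of `U` on which `w` is positive. -/
structure IsRepresentedBy (σ : Signature IsC IsD) (U : Submodule ℝ (E → ℝ)) (w : E → ℝ) :
    Prop where
  isD_iff : ∀ c, IsD c ↔ IsSignedCircuit U c
  isC_iff : ∀ C, IsC C ↔ ∃ c, IsD c ∧ Function.support c = C
  dotProduct_pos : ∀ C, IsC C → 0 < w ⬝ᵥ σ.dir C

namespace IsRepresentedBy

variable {σ : Signature IsC IsD} {U : Submodule ℝ (E → ℝ)} {w : E → ℝ}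

theorem isSignedCircuit_dir (h : IsRepresentedBy σ U w) {C : Set E} (hC : IsC C) :
    IsSignedCircuit U (σ.dir C) := (h.isD_iff _).1 (σ.isD_dir C hC)

theorem isC_support (h : IsRepresentedBy σ U w) {c : E → ℝ} (hc : IsSignedCircuit U c) :
    IsC (Function.support c) := (h.isC_iff _).2 ⟨c, (h.isD_iff c).2 hc, rfl⟩

theorem dir_support (h : IsRepresentedBy σ U w) {c : E → ℝ} (hc : IsSignedCircuit U c) :
    σ.dir (Function.support c) = c ∨ σ.dir (Function.support c) = -c := by
  refine hc.eq_or_eq_neg (h.isSignedCircuit_dir (h.isC_support hc)) fun e he => ?_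
  have := σ.support_dir _ (h.isC_support hc)
  by_contra hne
  have h1 : e ∈ Function.support c := this ▸ hne
  exact h1 he

theorem isGeneric (h : IsRepresentedBy σ U w) : IsGeneric U w := by
  intro c hc
  have h1 := h.dotProduct_pos _ (h.isC_support hc)
  rcases h.dir_support hc with h2 | h2 <;> rw [h2] at h1
  · exact h1.ne'
  · rw [dotProduct_neg] at h1
    linarith

theorem dir_support_of_pos (h : IsRepresentedBy σ U w) {c : E → ℝ} (hc : IsSignedCircuit U c)
    (hw : 0 < w ⬝ᵥ c) : σ.dir (Function.support c) = c := by
  have h1 := h.dotProduct_pos _ (h.isC_support hc)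
  rcases h.dir_support hc with h2 | h2
  · exact h2
  · rw [h2, dotProduct_neg] at h1
    linarith

theorem chooses_iff (h : IsRepresentedBy σ U w) {c : E → ℝ} (hc : IsSignedCircuit U c) :
    σ.Chooses c ↔ 0 < w ⬝ᵥ c := by
  constructor
  · rintro ⟨C, hC, rfl⟩
    exact h.dotProduct_pos C hC
  · exact fun hw => ⟨_, h.isC_support hc, h.dir_support_of_pos hc hw⟩

theorem forall_chooses_iff (h : IsRepresentedBy σ U w) (O : E → ℝ) :
    (∀ c, IsD c → IsIn c O → σ.Chooses c) ↔ ContainsOnlyChosen U w O := by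
  refine forall_congr' fun c => ?_
  rw [h.isD_iff]
  exact forall_congr' fun hc => by rw [h.chooses_iff hc]

end IsRepresentedBy

/-- A discrete orientation can move along a circuit `c` exactly when `-c` is in it. -/
theorem IsOrientation.mem_compatPoints_iff {U : Submodule ℝ (E → ℝ)} {w O : E → ℝ}
    (hw : IsGeneric U w) (hO : IsOrientation O) :
    O ∈ compatPoints U w ↔ ContainsOnlyChosen U w O := by
  constructor
  · intro h c hc hcO
    by_contra hneg
    have hlt := lt_of_le_of_ne (not_lt.1 hneg) (hw c hc)
    refine h.2 (-c) hc.neg (by rw [dotProduct_neg]; linarith) 1 one_pos (OrientedGraph.mem_cube.2 fun e => ?_)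
    have h1 := OrientedGraph.mem_cube.1 h.1 e
    simp only [one_smul, Pi.add_apply, Pi.neg_apply]
    rcases hc.values e with h2 | h2 | h2
    · simpa [h2] using h1
    · rw [hcO e (by simp [h2]), h2, arcCoord_one]
      norm_num
    · rw [hcO e (by simp [h2]), h2, arcCoord_neg_one]
      norm_num
  · refine fun h => ⟨hO.mem_cube, fun c hc hcw ε hε hmem => ?_⟩
    have h1 := h (-c) hc.neg fun e he => by
      have h2 := OrientedGraph.mem_cube.1 hmem e
      simp only [Pi.add_apply, Pi.smul_apply, smul_eq_mul] at h2
      rw [Pi.neg_apply] at he ⊢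
      rcases hc.values e with h3 | h3 | h3
      · simp [h3] at he
      · rw [h3] at h2 ⊢
        rw [arcCoord_neg_one]
        rcases hO e with h4 | h4
        · exact h4
        · linarith
      · rw [h3] at h2 ⊢
        rw [neg_neg, arcCoord_one]
        rcases hO e with h4 | h4
        · linarith
        · exact h4
    rw [dotProduct_neg] at h1
    linarith

/-- The supports of `τ` and of the fundamental circuit `c` meet at most in `e`, so the value of `w`
on `c` is `τ e * c e`, and it is positive. -/
theorem IsBaseData.arcCoord_eq_vertexCoord {U Us : Submodule ℝ (E → ℝ)} {w ws : E → ℝ} {T : Set E}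
    {t τ : E → ℝ} (h : IsBaseData U Us w ws T t τ) (hp : IsRegularPair U Us) {c : E → ℝ}
    (hc : IsSignedCircuit U c) (hcw : 0 < w ⬝ᵥ c) {e : E}
    (hsub : ∀ f, f ∉ T → f ≠ e → c f = 0) : arcCoord (c e) = vertexCoord (τ e) := by
  rw [dotProduct_eq_of_sub_mem hp hc.mem h.sub_mem_right,
    dotProduct_eq_single (e := e) fun f hf => ?_] at hcw
  · rcases hc.values e with h1 | h1 | h1
    · simp [h1] at hcw
    · rw [h1, mul_one] at hcw
      rw [h1, arcCoord_one, vertexCoord_of_pos hcw]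
    · rw [h1] at hcw
      rw [h1, arcCoord_neg_one, vertexCoord_of_neg (by linarith)]
  · by_cases hfT : f ∈ T
    · exact Or.inl (h.eq_zero_on f hfT)
    · exact Or.inr (hsub f hfT hf)

end Signatures

/-! ### Translation between the graph and the linear setting -/

section Graph

variable {V E : Type*} {G : OrientedGraph V E}

theorem isCocycle_iff (C : Set E) :
    G.IsCocycle C ↔ ∃ c, G.IsDirectedCocycle c ∧ Function.support c = C := by
  constructor
  · intro h
    obtain ⟨-, W, rfl⟩ := h.prop
    exact ⟨_, ⟨W, h, rfl⟩, G.support_cutVec W⟩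
  · rintro ⟨_, ⟨W, hW, rfl⟩, rfl⟩
    rwa [support_cutVec]

theorem SameCocycleClass.sub_mem {O O' : E → ℝ} (h : G.SameCocycleClass O O') :
    O' - O ∈ G.tensions ∧ IsIntegralVec (O' - O) := by
  induction h with
  | rel x y hxy =>
    obtain ⟨-, c, hc, -, rfl⟩ := hxy
    have hc' := hc.isSignedCircuit.neg
    rw [sub_sub_cancel_left]
    exact ⟨hc'.mem, isIntegralVec_of_values hc'.values⟩
  | refl x =>
    rw [sub_self]
    exact ⟨G.tensions.zero_mem, isIntegralVec_zero⟩
  | symm x y _ ih =>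
    rw [← neg_sub y x]
    exact ⟨G.tensions.neg_mem ih.1, by simpa using isIntegralVec_zero.sub ih.2⟩
  | trans x y z _ _ ih1 ih2 =>
    rw [← sub_add_sub_cancel z y x]
    exact ⟨G.tensions.add_mem ih2.1 ih1.1, ih2.2.add ih1.2⟩

theorem IsOrientation.sub_of_isIn {O c : E → ℝ} (hO : IsOrientation O)
    (hval : ∀ e, c e = 0 ∨ c e = 1 ∨ c e = -1) (hc : IsIn c O) : IsOrientation (O - c) := by
  intro e
  rw [Pi.sub_apply]
  rcases hval e with h | h | h
  · simpa [h] using hO e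
  · rw [hc e (by simp [h]), h, arcCoord_one]
    norm_num
  · rw [hc e (by simp [h]), h, arcCoord_neg_one]
    norm_num

theorem ReversesTo.sameCocycleClass {J : Finset (E → ℝ)} {O₁ O : E → ℝ} (hO₁ : IsOrientation O₁)
    (h : G.ReversesTo J O₁ O) : G.SameCocycleClass O₁ O := by
  classical
  induction J using Finset.induction_on generalizing O₁ with
  | empty =>
    obtain ⟨-, -, rfl⟩ := h
    rw [Finset.sum_empty, sub_zero]
    exact Relation.EqvGen.refl O₁
  | insert c J hcJ ih =>
    obtain ⟨h1, h2, rfl⟩ := h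
    have hc := h1 c (Finset.mem_insert_self c J)
    refine Relation.EqvGen.trans _ (O₁ - c) _
      (Relation.EqvGen.rel _ _ ⟨hO₁, c, hc.1, hc.2, rfl⟩)
      (ih (hO₁.sub_of_isIn hc.1.isSignedCircuit.values hc.2)
        ⟨fun d hd => ⟨(h1 d (Finset.mem_insert_of_mem hd)).1, fun e he => ?_⟩,
          fun d hd d' hd' => h2 d (Finset.mem_insert_of_mem hd) d' (Finset.mem_insert_of_mem hd'),
          ?_⟩)
    · have hne : c ≠ d := fun h => hcJ (h ▸ hd)
      have h3 : c e = 0 := by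
        by_contra h4
        exact Set.disjoint_left.1 (h2 c (Finset.mem_insert_self c J) d
          (Finset.mem_insert_of_mem hd) hne) h4 he
      rw [Pi.sub_apply, h3, sub_zero]
      exact (h1 d (Finset.mem_insert_of_mem hd)).2 e he
    · rw [Finset.sum_insert hcJ]
      abel

variable [Fintype E]

/-- The difference is a `{0, ±1}`-tension, hence a sum of disjoint cocycles conforming to it.
Conformity means precisely that they are in `O₁`. -/
theorem IsOrientation.exists_reversesTo {O₁ O : E → ℝ} (hO₁ : IsOrientation O₁)
    (hO : IsOrientation O) (h : O₁ - O ∈ G.tensions) : ∃ J, G.ReversesTo J O₁ O := by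
  have hconf : HasConformalCircuits G.tensions := fun s hs hs0 => by
    obtain ⟨c, hc, hcs⟩ := G.exists_isDirectedCocycle_conformsTo hs hs0
    exact ⟨c, hc.isSignedCircuit, hcs⟩
  obtain ⟨J, hJ, hdisj, hsum⟩ := hconf.exists_disjoint_sum h fun e => by
    rw [Pi.sub_apply]
    rcases hO₁ e with h1 | h1 <;> rcases hO e with h2 | h2 <;> rw [h1, h2] <;> norm_num
  refine ⟨J, fun c hc => ⟨(G.isDirectedCocycle_iff c).2 (hJ c hc).1, fun e he => ?_⟩, hdisj, ?_⟩
  · have h1 := (hJ c hc).2 e he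
    rw [Pi.sub_apply] at h1
    rcases (hJ c hc).1.values e with h2 | h2 | h2
    · exact absurd h2 he
    · rw [h2] at h1 ⊢
      rw [arcCoord_one]
      rcases hO₁ e with h3 | h3 <;> rcases hO e with h4 | h4 <;> rw [h3, h4] at h1 <;>
        first | exact h3 | norm_num at h1
    · rw [h2] at h1 ⊢
      rw [arcCoord_neg_one]
      rcases hO₁ e with h3 | h3 <;> rcases hO e with h4 | h4 <;> rw [h3, h4] at h1 <;>
        first | exact h3 | norm_num at h1
  · rw [← hsum, sub_sub_cancel]

omit [Fintype E] in
theorem sum_apply_eq_zero_iff_of_disjoint {J : Finset (E → ℝ)}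
    (hJ : ∀ c ∈ J, ∀ d ∈ J, c ≠ d → Disjoint (Function.support c) (Function.support d)) (e : E) :
    (∑ c ∈ J, c) e = 0 ↔ ∀ c ∈ J, c e = 0 := by
  rw [Finset.sum_apply]
  refine ⟨fun h c hc => ?_, fun h => Finset.sum_eq_zero h⟩
  by_contra hne
  rw [Finset.sum_eq_single_of_mem c hc fun d hd hdc => ?_] at h
  · exact hne h
  · by_contra hde
    exact Set.disjoint_left.1 (hJ d hd c hc hdc) hde hne

variable [Finite V] {σ : G.CycleSignature} {σs : G.CocycleSignature} {w ws : E → ℝ} {T : Set E}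

omit [Finite V] in
theorem compatSet_eq (hσ : IsRepresentedBy σ G.flows w) : compatSet σ = compatPoints G.flows w := by
  ext x
  refine and_congr_right fun _ => ⟨fun h c hc hcw => ?_, fun h C hC => ?_⟩
  · rw [← hσ.dir_support_of_pos hc hcw]
    exact h _ (hσ.isC_support hc)
  · exact h _ (hσ.isSignedCircuit_dir hC) (hσ.dotProduct_pos C hC)

omit [Finite V] in
theorem isCompat_iff (hσ : IsRepresentedBy σ G.flows w) (O : E → ℝ) :
    IsCompat σ O ↔ IsOrientation O ∧ O ∈ compatPoints G.flows w :=
  and_congr_right fun hO => by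
    rw [hO.mem_compatPoints_iff hσ.isGeneric, ← hσ.forall_chooses_iff]

omit [Finite V] in
theorem isCocompat_iff (hσs : IsRepresentedBy σs G.tensions ws) (O : E → ℝ) :
    IsCocompat σs O ↔ IsOrientation O ∧ ContainsOnlyChosen G.tensions ws O :=
  and_congr_right fun _ => hσs.forall_chooses_iff O

theorem IsBase.fundCycle_spec (hT : IsBase G.flows G.tensions T) {e : E} (he : e ∉ T) :
    G.IsCycle (G.fundCycle T e) ∧ G.fundCycle T e ⊆ insert e T := by
  refine Classical.epsilon_spec (p := fun C => G.IsCycle C ∧ C ⊆ insert e T) ?_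
  obtain ⟨c, hc, -, hoff⟩ := G.isRegularPair.exists_fundamental hT he
  refine ⟨_, ⟨c, (G.isDirectedCycle_iff c).2 hc, rfl⟩, fun f hf => ?_⟩
  by_contra hne
  rw [Set.mem_insert_iff, not_or] at hne
  exact hf (hoff f hne.2 hne.1)

theorem IsBase.fundCocycle_spec (hT : IsBase G.flows G.tensions T) {e : E} (he : e ∈ T) :
    G.IsCocycle (G.fundCocycle T e) ∧ G.fundCocycle T e ⊆ insert e Tᶜ := by
  refine Classical.epsilon_spec (p := fun C => G.IsCocycle C ∧ C ⊆ insert e Tᶜ) ?_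
  obtain ⟨c, hc, -, hoff⟩ := G.isRegularPair.symm.exists_fundamental hT.symm (e := e)
    (fun h => h he)
  refine ⟨_, (isCocycle_iff _).2 ⟨c, (G.isDirectedCocycle_iff c).2 hc, rfl⟩, fun f hf => ?_⟩
  by_contra hne
  rw [Set.mem_insert_iff, not_or] at hne
  exact hf (hoff f hne.2 hne.1)

variable {t τ : E → ℝ}

theorem IsBaseData.arcCoord_fundCycle (h : IsBaseData G.flows G.tensions w ws T t τ)
    (hσ : IsRepresentedBy σ G.flows w) {e : E} (he : e ∉ T) :
    arcCoord (σ.dir (G.fundCycle T e) e) = vertexCoord (τ e) := by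
  obtain ⟨hC, hsub⟩ := h.isBase.fundCycle_spec he
  refine h.arcCoord_eq_vertexCoord G.isRegularPair (hσ.isSignedCircuit_dir hC)
    (hσ.dotProduct_pos _ hC) fun f hf hfe => ?_
  by_contra hne
  have h1 : f ∈ G.fundCycle T e := σ.support_dir _ hC ▸ hne
  rcases hsub h1 with h2 | h2
  · exact hfe h2
  · exact hf h2

theorem IsBaseData.arcCoord_fundCocycle (h : IsBaseData G.flows G.tensions w ws T t τ)
    (hσs : IsRepresentedBy σs G.tensions ws) {e : E} (he : e ∈ T) :
    arcCoord (σs.dir (G.fundCocycle T e) e) = vertexCoord (t e) := by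
  obtain ⟨hC, hsub⟩ := h.isBase.fundCocycle_spec he
  refine h.symm.arcCoord_eq_vertexCoord G.isRegularPair.symm (hσs.isSignedCircuit_dir hC)
    (hσs.dotProduct_pos _ hC) fun f hf hfe => ?_
  by_contra hne
  have h1 : f ∈ G.fundCocycle T e := σs.support_dir _ hC ▸ hne
  rcases hsub h1 with h2 | h2
  · exact hfe h2
  · exact hf h2

theorem IsBaseData.hoc_eq (h : IsBaseData G.flows G.tensions w ws T t τ)
    (hσ : IsRepresentedBy σ G.flows w) (hσs : IsRepresentedBy σs G.tensions ws) :
    hoc σ σs T = halfOpenCell T t τ := by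
  ext x
  refine and_congr_right fun _ => and_congr (forall₂_congr fun e he => ?_)
    (forall₂_congr fun e he => ?_)
  · rw [h.arcCoord_fundCycle hσ he]
  · rw [h.arcCoord_fundCocycle hσs he]

theorem IsBaseData.geomOrientation_eq (h : IsBaseData G.flows G.tensions w ws T t τ)
    (hσ : IsRepresentedBy σ G.flows w) (hσs : IsRepresentedBy σs G.tensions ws) {y : E → ℝ}
    (hy : y ∈ halfOpenCell T t τ) (hyO : IsOrientation y) : geomOrientation σ σs T = y := by
  ext e
  unfold geomOrientation
  split_ifs with he
  · rw [h.arcCoord_fundCocycle hσs he, hyO.eq_vertexCoord hy he]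
  · rw [h.arcCoord_fundCycle hσ he, hy.2.1 e he]

theorem IsBaseData.geomOrientation_mem (h : IsBaseData G.flows G.tensions w ws T t τ)
    (hσ : IsRepresentedBy σ G.flows w) (hσs : IsRepresentedBy σs G.tensions ws) :
    IsOrientation (geomOrientation σ σs T) ∧ geomOrientation σ σs T ∈ halfOpenCell T t τ := by
  have hon : ∀ e, e ∈ T → geomOrientation σ σs T e = vertexCoord (t e) := fun e he => by
    rw [← h.arcCoord_fundCocycle hσs he]
    simp [geomOrientation, he]
  have hoff : ∀ e, e ∉ T → geomOrientation σ σs T e = vertexCoord (τ e) := fun e he => by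
    rw [← h.arcCoord_fundCycle hσ he]
    simp [geomOrientation, he]
  have hO : IsOrientation (geomOrientation σ σs T) := fun e => by
    by_cases he : e ∈ T
    · rw [hon e he]
      exact vertexCoord_eq _
    · rw [hoff e he]
      exact vertexCoord_eq _
  exact ⟨hO, hO.mem_cube, hoff, fun e he => Or.inl (hon e he)⟩

omit [Fintype E] [Finite V] in
theorem mem_cell_iff {c x : E → ℝ} :
    x ∈ cell σ σs T c ↔ x ∈ cube E ∧ x + c ∈ hoc σ σs T := by
  constructor
  · rintro ⟨⟨y, hy, rfl⟩, hx⟩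
    exact ⟨hx, by simpa using hy⟩
  · rintro ⟨hx, hxc⟩
    exact ⟨⟨x + c, hxc, by simp⟩, hx⟩

end Graph

end OrientedGraph

/-! ### The theorem -/

open OrientedGraph in
theorem proposition3p17 {V E : Type*} [Fintype V] [Fintype E] (G : OrientedGraph V E)
    (hG : G.IsConnected) (q : V)
    (σ : G.CycleSignature) (σs : G.CocycleSignature) (hσ : σ.IsAcyclic) (hσs : σs.IsAcyclic) :
    -- the decomposition into the cells, indexed by pairs (spanning tree, integral cocycle vector)
    (OrientedGraph.compatSet σ =
      ⋃ p ∈ {p : Set E × (E → ℝ) | G.IsSpanningTree p.1 ∧ p.2 ∈ G.intCocycleSpace q},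
        OrientedGraph.cell σ σs p.1 p.2) ∧
    ({p : Set E × (E → ℝ) | G.IsSpanningTree p.1 ∧ p.2 ∈ G.intCocycleSpace q}.PairwiseDisjoint
        fun p => OrientedGraph.cell σ σs p.1 p.2) ∧
    (∀ T, G.IsSpanningTree T → ∀ c ∈ G.intCocycleSpace q, (OrientedGraph.cell σ σs T c).Nonempty →
        ∃ F, OrientedGraph.IsStandardCell (OrientedGraph.cell σ σs T c) F ∧ G.IsForest F ∧ F ⊆ T) ∧
    -- the inverse of `g`, the representative `O^cp` and the reversed cocycles are well defined
    Set.BijOn (OrientedGraph.geomOrientation σ σs) {T | G.IsSpanningTree T}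
        {O | OrientedGraph.IsCompat σ O ∧ OrientedGraph.IsCocompat σs O} ∧
    (∀ O, OrientedGraph.IsCompat σ O →
        (∃! Ocp, (OrientedGraph.IsCompat σ Ocp ∧ OrientedGraph.IsCocompat σs Ocp) ∧
          G.SameCocycleClass O Ocp) ∧
        ∀ Ocp, (OrientedGraph.IsCompat σ Ocp ∧ OrientedGraph.IsCocompat σs Ocp) →
          G.SameCocycleClass O Ocp →
          ∃ J, G.ReversesTo J Ocp O) ∧
    -- the map sending `O` to the generating forest of the cell that contains it
    ∃ φ : {O : E → ℝ // OrientedGraph.IsCompat σ O} → {F : Set E // G.IsForest F},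
      (∀ O F, (φ O).1 = F ↔
        ∃ T c, G.IsSpanningTree T ∧ c ∈ G.intCocycleSpace q ∧ O.1 ∈ OrientedGraph.cell σ σs T c ∧
          OrientedGraph.IsStandardCell (OrientedGraph.cell σ σs T c) F) ∧
      (∀ O Ocp, (OrientedGraph.IsCompat σ Ocp ∧ OrientedGraph.IsCocompat σs Ocp) →
          G.SameCocycleClass O.1 Ocp →
        ∀ J, G.ReversesTo J Ocp O.1 →
          ∀ T, G.IsSpanningTree T → OrientedGraph.geomOrientation σ σs T = Ocp →
            (φ O).1 = T \ ⋃ c ∈ J, Function.support c) ∧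
      Function.Bijective φ := by
  obtain ⟨w, hw⟩ := hσ.exists_dotProduct_pos
  obtain ⟨ws, hws⟩ := hσs.exists_dotProduct_pos
  have hrσ : IsRepresentedBy σ G.flows w := ⟨G.isDirectedCycle_iff, fun _ => Iff.rfl, hw⟩
  have hrσs : IsRepresentedBy σs G.tensions ws := ⟨G.isDirectedCocycle_iff, isCocycle_iff, hws⟩
  have hp := G.isRegularPair
  have hgw := hrσ.isGeneric
  have hgws := hrσs.isGeneric
  have hdata : ∀ T, G.IsSpanningTree T → ∃ t τ, IsBaseData G.flows G.tensions w ws T t τ :=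
    fun T hT => ((G.isSpanningTree_iff hG T).1 hT).exists_isBaseData hp hgw hgws
  have htree : ∀ {T t τ}, IsBaseData G.flows G.tensions w ws T t τ → G.IsSpanningTree T :=
    fun h => (G.isSpanningTree_iff hG _).2 h.isBase
  have hcover : ∀ x ∈ compatPoints G.flows w, ∃ T c, G.IsSpanningTree T ∧
      c ∈ G.intCocycleSpace q ∧ x ∈ cell σ σs T c := by
    intro x hx
    obtain ⟨c, hc, hint, hxc, hco⟩ := hp.exists_add_containsOnlyChosen hgws hx
    obtain ⟨T, t, τ, h, hmem⟩ := hp.exists_mem_halfOpenCell hgw hgws hxc hco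
    exact ⟨T, c, htree h, (G.mem_intCocycleSpace_iff q c).2 ⟨hc, hint⟩,
      mem_cell_iff.2 ⟨hx.1, by rwa [h.hoc_eq hrσ hrσs]⟩⟩
  have hunique : ∀ {x T T' c c'}, G.IsSpanningTree T → G.IsSpanningTree T' →
      c ∈ G.intCocycleSpace q → c' ∈ G.intCocycleSpace q → x ∈ cell σ σs T c →
      x ∈ cell σ σs T' c' → T = T' ∧ c = c' := by
    intro x T T' c c' hT hT' hc hc' hx hx'
    obtain ⟨t, τ, h⟩ := hdata T hT
    obtain ⟨t', τ', h'⟩ := hdata T' hT'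
    rw [mem_cell_iff, h.hoc_eq hrσ hrσs] at hx
    rw [mem_cell_iff, h'.hoc_eq hrσ hrσs] at hx'
    rw [mem_intCocycleSpace_iff] at hc hc'
    have hsub : x + c' - (x + c) = c' - c := by abel
    obtain ⟨h1, h2⟩ := h.eq_of_mem h' hp hx.2 hx'.2
      (by rw [hsub]; exact G.tensions.sub_mem hc'.1 hc.1) (by rw [hsub]; exact hc'.2.sub hc.2)
    exact ⟨h1, add_left_cancel h2⟩
  have hstd : ∀ {x T c}, G.IsSpanningTree T → c ∈ G.intCocycleSpace q → x ∈ cell σ σs T c →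
      IsStandardCell (cell σ σs T c) {e | e ∈ T ∧ c e = 0} := by
    intro x T c hT hc hx
    obtain ⟨t, τ, h⟩ := hdata T hT
    rw [mem_cell_iff, h.hoc_eq hrσ hrσs] at hx
    rw [cell, h.hoc_eq hrσ hrσs]
    exact h.isStandardCell hx.1 ((G.mem_intCocycleSpace_iff q c).1 hc).2 hx.2
  have hsubset : ∀ {T : Set E} {c : E → ℝ}, {e | e ∈ T ∧ c e = 0} ⊆ T := fun he => he.1
  have hforest : ∀ {T : Set E} {c : E → ℝ}, G.IsSpanningTree T →
      G.IsForest {e | e ∈ T ∧ c e = 0} :=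
    fun hT C hC hsub => hT.1 C hC (hsub.trans hsubset)
  have hboth : ∀ {O}, IsCompat σ O ∧ IsCocompat σs O → IsOrientation O ∧
      ∃ T t τ, IsBaseData G.flows G.tensions w ws T t τ ∧ O ∈ halfOpenCell T t τ := by
    rintro O ⟨h1, h2⟩
    rw [isCompat_iff hrσ] at h1
    rw [isCocompat_iff hrσs] at h2
    exact ⟨h1.1, hp.exists_mem_halfOpenCell hgw hgws h1.2 h2.2⟩
  have hboth' : ∀ {O T t τ}, IsOrientation O → IsBaseData G.flows G.tensions w ws T t τ →
      O ∈ halfOpenCell T t τ → IsCompat σ O ∧ IsCocompat σs O := by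
    intro O T t τ hO h hmem
    rw [isCompat_iff hrσ, isCocompat_iff hrσs]
    exact ⟨⟨hO, h.mem_compatPoints hp hmem⟩, hO, h.containsOnlyChosen hp hgws hmem⟩
  refine ⟨?_, ?_, ?_, ⟨?_, ?_, ?_⟩, ?_, ?_⟩
  · rw [compatSet_eq hrσ]
    ext x
    simp only [Set.mem_iUnion, exists_prop]
    constructor
    · intro hx
      obtain ⟨T, c, hT, hc, hmem⟩ := hcover x hx
      exact ⟨(T, c), ⟨hT, hc⟩, hmem⟩
    · rintro ⟨⟨T, c⟩, ⟨hT, hc⟩, hmem⟩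
      obtain ⟨t, τ, h⟩ := hdata T hT
      rw [mem_cell_iff, h.hoc_eq hrσ hrσs] at hmem
      rw [mem_intCocycleSpace_iff] at hc
      have := hp.add_mem_compatPoints (h.mem_compatPoints hp hmem.2) (G.tensions.neg_mem hc.1)
        (by simpa using isIntegralVec_zero.sub hc.2) (by simpa using hmem.1)
      simpa using this
  · rintro ⟨T, c⟩ ⟨hT, hc⟩ ⟨T', c'⟩ ⟨hT', hc'⟩ hne
    refine Set.disjoint_left.2 fun x hx hx' => hne ?_
    obtain ⟨h1, h2⟩ := hunique hT hT' hc hc' hx hx'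
    exact Prod.ext h1 h2
  · rintro T hT c hc ⟨x, hx⟩
    exact ⟨_, hstd hT hc hx, hforest hT, hsubset⟩
  · intro T hT
    obtain ⟨t, τ, h⟩ := hdata T hT
    obtain ⟨hO, hmem⟩ := h.geomOrientation_mem hrσ hrσs
    exact hboth' hO h hmem
  · intro T hT T' hT' heq
    obtain ⟨t, τ, h⟩ := hdata T hT
    obtain ⟨t', τ', h'⟩ := hdata T' hT'
    have h1 := (h.geomOrientation_mem hrσ hrσs).2
    have h2 := (h'.geomOrientation_mem hrσ hrσs).2
    rw [← heq] at h2
    refine (h.eq_of_mem h' hp h1 h2 ?_ ?_).1 <;> rw [sub_self]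
    · exact G.tensions.zero_mem
    · exact isIntegralVec_zero
  · intro O hO
    obtain ⟨hor, T, t, τ, h, hmem⟩ := hboth hO
    exact ⟨T, htree h, h.geomOrientation_eq hrσ hrσs hmem hor⟩
  · intro O hO
    have hO' := (isCompat_iff hrσ O).1 hO
    have hJ : ∀ Ocp, (IsCompat σ Ocp ∧ IsCocompat σs Ocp) → Ocp - O ∈ G.tensions →
        ∃ J, G.ReversesTo J Ocp O := fun Ocp h1 h2 =>
      h1.1.1.exists_reversesTo hO.1 h2
    refine ⟨?_, fun Ocp h1 h2 => hJ Ocp h1 h2.sub_mem.1⟩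
    -- The representative is `O + c` for the translation maximising `ws`. Its uniqueness is
    -- `IsBaseData.eq_of_mem`, as orientations in one class differ by integral tensions.
    obtain ⟨c, hc, hint, hxc, hco⟩ := hp.exists_add_containsOnlyChosen hgws hO'.2
    have hor : IsOrientation (O + c) := (hO.1.isIntegral.add hint).isOrientation hxc.1
    have hcp : IsCompat σ (O + c) ∧ IsCocompat σs (O + c) := by
      rw [isCompat_iff hrσ, isCocompat_iff hrσs]
      exact ⟨⟨hor, hxc⟩, hor, hco⟩
    obtain ⟨J, hJr⟩ := hJ _ hcp (by simpa using hc)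
    refine ⟨O + c, ⟨hcp, (hJr.sameCocycleClass hor).symm⟩, ?_⟩
    rintro O' ⟨h1, h2⟩
    obtain ⟨-, T, t, τ, h, hmem⟩ := hboth hcp
    obtain ⟨-, T', t', τ', h', hmem'⟩ := hboth h1
    have hsub := h2.sub_mem
    have heq : O' - (O + c) = (O' - O) - c := by abel
    exact (h.eq_of_mem h' hp hmem hmem' (by rw [heq]; exact G.tensions.sub_mem hsub.1 hc)
      (by rw [heq]; exact hsub.2.sub hint)).2.symm
  · have hcover' : ∀ O : {O : E → ℝ // IsCompat σ O}, ∃ p : Set E × (E → ℝ),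
        G.IsSpanningTree p.1 ∧ p.2 ∈ G.intCocycleSpace q ∧ O.1 ∈ cell σ σs p.1 p.2 := by
      intro O
      obtain ⟨T, c, h⟩ := hcover O.1 ((isCompat_iff hrσ O.1).1 O.2).2
      exact ⟨(T, c), h⟩
    choose p hpT hpc hpO using hcover'
    have hφ : ∀ O {T c}, G.IsSpanningTree T → c ∈ G.intCocycleSpace q → O.1 ∈ cell σ σs T c →
        {e | e ∈ (p O).1 ∧ (p O).2 e = 0} = {e | e ∈ T ∧ c e = 0} := by
      intro O T c hT hc hmem
      obtain ⟨h1, h2⟩ := hunique (hpT O) hT (hpc O) hc (hpO O) hmem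
      rw [h1, h2]
    refine ⟨fun O => ⟨{e | e ∈ (p O).1 ∧ (p O).2 e = 0}, hforest (hpT O)⟩, ?_, ?_, ?_, ?_⟩
    · intro O F
      constructor
      · rintro rfl
        exact ⟨_, _, hpT O, hpc O, hpO O, hstd (hpT O) (hpc O) (hpO O)⟩
      · rintro ⟨T, c, hT, hc, hmem, hF⟩
        exact (hφ O hT hc hmem).trans ((hstd hT hc hmem).unique hF ⟨_, hmem⟩)
    · rintro O Ocp hcp - J ⟨hJ, hdisj, hO⟩ T hT hgeom
      obtain ⟨t, τ, h⟩ := hdata T hT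
      have hmem : Ocp ∈ halfOpenCell T t τ := hgeom ▸ (h.geomOrientation_mem hrσ hrσs).2
      -- The sum of the reversed cocycles is the translation of the cell containing `O`. Their
      -- supports being disjoint, it vanishes exactly off their union.
      have hc : ∑ c ∈ J, c ∈ G.intCocycleSpace q := by
        rw [mem_intCocycleSpace_iff]
        refine ⟨G.tensions.sum_mem fun c hc => (hJ c hc).1.isSignedCircuit.mem, ?_⟩
        have : ∑ c ∈ J, c = Ocp - O.1 := by rw [hO, sub_sub_cancel]
        rw [this]
        exact hcp.1.1.isIntegral.sub O.2.1.isIntegral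
      refine (hφ O hT hc (mem_cell_iff.2 ⟨O.2.1.mem_cube, ?_⟩)).trans ?_
      · rw [h.hoc_eq hrσ hrσs, hO, sub_add_cancel]
        exact hmem
      · ext e
        simp only [Set.mem_sdiff, Set.mem_iUnion, Function.mem_support, not_exists, not_not]
        exact and_congr_right fun _ => sum_apply_eq_zero_iff_of_disjoint hdisj e
    · intro O O' heq
      obtain ⟨t, τ, h⟩ := hdata _ (hpT O)
      obtain ⟨t', τ', h'⟩ := hdata _ (hpT O')
      have hm := hpO O
      have hm' := hpO O'
      rw [mem_cell_iff, h.hoc_eq hrσ hrσs] at hm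
      rw [mem_cell_iff, h'.hoc_eq hrσ hrσs] at hm'
      have hc := (G.mem_intCocycleSpace_iff q _).1 (hpc O)
      have hc' := (G.mem_intCocycleSpace_iff q _).1 (hpc O')
      obtain ⟨h1, h2⟩ := h.eq_of_generatingSet_eq h' hp hm.1 hm'.1 hc.1 hc'.1 hc.2 hc'.2
        hm.2 hm'.2 (congrArg Subtype.val heq)
      -- Both translated orientations equal the vertex given by the common tree, and the
      -- translations coincide, so `O = O'`.
      have h3 := h.geomOrientation_eq hrσ hrσs hm.2
        ((O.2.1.isIntegral.add hc.2).isOrientation hm.2.1)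
      have h4 := h'.geomOrientation_eq hrσ hrσs hm'.2
        ((O'.2.1.isIntegral.add hc'.2).isOrientation hm'.2.1)
      rw [h1, h4, h2] at h3
      exact Subtype.ext (add_right_cancel h3.symm)
    · rintro ⟨F, hF⟩
      obtain ⟨T, t, τ, h, c, hc, hint, x, hx, hxc, hgen⟩ :=
        hp.exists_generatingSet_eq hgw hgws ((G.isForest_iff F).1 hF)
      have hcomp : IsCompat σ x := by
        rw [isCompat_iff hrσ]
        have := hp.add_mem_compatPoints (h.mem_compatPoints hp hxc) (G.tensions.neg_mem hc)
          (by simpa using isIntegralVec_zero.sub hint) (by simpa using hx.mem_cube)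
        exact ⟨hx, by simpa using this⟩
      refine ⟨⟨x, hcomp⟩, Subtype.ext ?_⟩
      exact (hφ ⟨x, hcomp⟩ (htree h) ((G.mem_intCocycleSpace_iff q c).2 ⟨hc, hint⟩)
        (mem_cell_iff.2 ⟨hx.mem_cube, by rwa [h.hoc_eq hrσ hrσs]⟩)).trans hgen
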